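/- Let $n=2m$ be even. Alice and Bob share a unit vector $|\psi'\rangle\in\mathcal H_A\otimes\mathcal H_B$, where $\mathcal H_A,\mathcal H_B$ are complex Hilbert spaces of arbitrary dimension. For every string of questions $S\in\{X,Z,D,E\}^{m}$, each player has a projective measurement on their own space, $\{\Pi^{A_S}_a\}_a$ for Alice and $\{\Pi^{B_S}_a\}_a$ for Bob, with outcomes $a\in\{-1,1\}^{m}$. For $1\le k\le m$ let $M'^{A_S}_k=\sum_{a:a_k=1}\Pi^{A_S}_a-\sum_{a:a_k=-1}\Pi^{A_S}_a$ (acting on $\mathcal H_A\otimes\mathcal H_B$ as $M'^{A_S}_k\otimes 1$), and let $M'^{B_S}_k$ be the analogous operator of Bob (acting as $1\otimes M'^{B_S}_k$). For $1\le k\le m$ and $T\in\{X,Z,D,E\}$ put $T'_k=M'^{A_{T\cdots T}}_k$ and $T'_{k+m}=M'^{B_{T\cdots T}}_k$; this defines $X'_k,Z'_k,D'_k,E'_k$ for $1\le k\le n$. For $t\in\{0,1\}^n$ write $X'^t=\prod_{k=1}^nX_k'^{\,t_k}$ and $Z'^t=\prod_{k=1}^nZ_k'^{\,t_k}$ (index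 increasing from left to right), and write $|t|$ for the Hamming weight of $t$. Let $X_k,Z_k$ be the Pauli operators on qubit $k$ of $(\mathbb C^2)^{\otimes n}$, with $X^t,Z^t$ defined likewise, and let $$|\psi\rangle=\Big(\tfrac12\big(|00\rangle+|01\rangle+|10\rangle-|11\rangle\big)\Big)^{\otimes m}\in(\mathbb C^2)^{\otimes n},$$ where the $k$-th factor lives on qubits $k$ (Alice) and $k+m$ (Bob). Let $\epsilon$ be a real number. Suppose that for every $k\in\{1,\dots,m\}$ $$\langle\psi'|\big[X'_k(D'_{k+m}-E'_{k+m})+Z'_k(D'_{k+m}+E'_{k+m})\big]|\psi'\rangle\ge 2\sqrt2-\epsilon,$$ $$\langle\psi'|\big[X'_{k+m}(D'_{k}-E'_{k})+Z'_{k+m}(D'_{k}+E'_{k})\big]|\psi'\rangle\ge 2\sqrt2-\epsilon,$$ and that for all question strings $q,r\in\{X,Z\}^{m}$ and every $k\in\{1,\dots,m\}$ such that $r_k$ is the complement of $q_k$ (that is, $\{q_k,r_k\}=\{X,Z\}$) $$\langle\psi'|\,M'^{A_q}_k\,M'^{B_r}_k\,|\psi'\rangle\ge 1-\epsilon .$$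 Then there exist a Hilbert space $\mathcal J$, a unit vector $|junk\rangle\in\mathcal J$ and a linear isometry $\Phi:\mathcal H_A\otimes\mathcal H_B\to\mathcal J\otimes(\mathbb C^2)^{\otimes n}$ such that for all $p,q\in\{0,1\}^n$ $$\Big\|\Phi\big(X'^qZ'^p|\psi'\rangle\big)-|junk\rangle\otimes X^qZ^p|\psi\rangle\Big\|\le\sqrt{\sqrt{2\epsilon}\Big(\frac{9n^2}{4}+\frac{(3+2^{5/4})n}{2}\Big)}+\sqrt{\sqrt{2\epsilon}\Big[\frac{9n^2}{8}+n\Big(\frac{5|p|}{2}-\frac14+\frac1{2^{3/4}}\Big)+|p|\Big(2^{1/4}-\frac12\Big)\Big]}.$$ (For $n>0$ the hypotheses force $\epsilon\ge0$; for $n=0$ the right-hand side is $0$.) -/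

import Mathlib

open scoped TensorProduct

universe u v

noncomputable section

namespace ParallelSelfTest

/-! ### Bit strings and operators raised to bit strings -/

/-- `n`-bit strings; bitwise exclusive or is addition, and `hammingNorm t` is the Hamming
weight `|t|`. -/
abbrev BitString (n : ℕ) : Type := Fin n → ZMod 2

/-- `X ^ t = X_1 ^ t_1 * X_2 ^ t_2 * ⋯ * X_n ^ t_n`, the index increasing from left to right. -/
def bitPow {M : Type*} [Monoid M] {n : ℕ} (X : Fin n → M) (t : BitString n) : M :=
  (List.ofFn fun k => X k ^ (t k).val).prod

/-! ### The ideal qubits -/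

/-- The space `(ℂ²)^{⊗ n}` of `n` qubits; the amplitude of a vector `f` at the computational basis
state `|u⟩` is `f u`. -/
abbrev Qubits (n : ℕ) : Type := EuclideanSpace ℂ (BitString n)

/-- The Pauli operator `X` on qubit `k`: it maps `|u⟩` to `|u ⊕ 1_k⟩`. -/
def pauliX {n : ℕ} (k : Fin n) : Module.End ℂ (Qubits n) where
  toFun f := WithLp.toLp 2 fun u => f (u + Pi.single k 1)
  map_add' f g := by ext u; simp
  map_smul' c f := by ext u; simp

/-- The Pauli operator `Z` on qubit `k`: it maps `|u⟩` to `(-1) ^ u_k |u⟩`. -/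
def pauliZ {n : ℕ} (k : Fin n) : Module.End ℂ (Qubits n) where
  toFun f := WithLp.toLp 2 fun u => (-1 : ℂ) ^ (u k).val * f u
  map_add' f g := by ext u; simp [mul_add]
  map_smul' c f := by ext u; simp [mul_left_comm]

/-- The state `(½ (|00⟩ + |01⟩ + |10⟩ - |11⟩))^{⊗ m}` of `m` e-bits, where Alice's qubit `k` (among
the first `m` qubits) is paired with Bob's qubit `k` (among the last `m` qubits). The amplitude
of a pair at `|ab⟩` is `½ (-1) ^ (a b)`. -/
def idealState (m : ℕ) : Qubits (m + m) :=
  WithLp.toLp 2 fun u => ∏ k : Fin m,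
    (1 / 2 : ℂ) * (-1) ^ ((u (Fin.castAdd m k)).val * (u (Fin.natAdd m k)).val)

/-! ### Bipartite Hilbert spaces -/

/-- The Hilbert space tensor product of `HA` and `HB`: the completion of the algebraic tensor
product with respect to `⟪a ⊗ b, a' ⊗ b'⟫ = ⟪a, a'⟫ ⟪b, b'⟫`. -/
abbrev HilbertTensor (HA : Type u) (HB : Type v)
    [NormedAddCommGroup HA] [InnerProductSpace ℂ HA]
    [NormedAddCommGroup HB] [InnerProductSpace ℂ HB] : Type (max u v) :=
  UniformSpace.Completion (HA ⊗[ℂ] HB)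

section Players

variable {HA : Type u} {HB : Type v}
  [NormedAddCommGroup HA] [InnerProductSpace ℂ HA]
  [NormedAddCommGroup HB] [InnerProductSpace ℂ HB]

/-- `T ⊗ 1`: an operator of Alice on the joint Hilbert space. -/
def onAlice (T : HA →L[ℂ] HA) : HilbertTensor HA HB →L[ℂ] HilbertTensor HA HB :=
  (TensorProduct.mapL T (ContinuousLinearMap.id ℂ HB)).completion

/-- `1 ⊗ T`: an operator of Bob on the joint Hilbert space. -/
def onBob (T : HB →L[ℂ] HB) : HilbertTensor HA HB →L[ℂ] HilbertTensor HA HB :=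
  (TensorProduct.mapL (ContinuousLinearMap.id ℂ HA) T).completion

end Players

/-! ### Measurements -/

/-- A projective measurement on the Hilbert space `H` with outcomes in the finite set `O`. -/
structure ProjMeasurement (O : Type) [Fintype O] (H : Type*)
    [NormedAddCommGroup H] [InnerProductSpace ℂ H] [CompleteSpace H] where
  /-- the projection of an outcome -/
  proj : O → H →L[ℂ] H
  isStarProjection : ∀ a, IsStarProjection (proj a)
  orthogonal : ∀ a b, a ≠ b → proj a * proj b = 0
  sum_eq_one : ∑ a, proj a = 1

/-- Answers are strings of `m` signs. -/
abbrev Answer (m : ℕ) : Type := Fin m → ℤˣ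

section Observables

variable {H : Type*} [NormedAddCommGroup H] [InnerProductSpace ℂ H] [CompleteSpace H] {m : ℕ}

/-- `Γ_{k,x}`: the projection on the event that the `k`-th symbol of the answer is `x`. -/
def ProjMeasurement.symbolProj (P : ProjMeasurement (Answer m) H) (k : Fin m) (x : ℤˣ) :
    H →L[ℂ] H :=
  ∑ a : Answer m with a k = x, P.proj a

/-- The `±1`-valued observable `Γ_{k,1} - Γ_{k,-1}` of the `k`-th symbol of the answer. -/
def ProjMeasurement.observable (P : ProjMeasurement (Answer m) H) (k : Fin m) : H →L[ℂ] H :=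
  P.symbolProj k 1 - P.symbolProj k (-1)

end Observables

/-! ### The strictly parallel test -/

/-- The questions of a single sub-test. -/
inductive Setting : Type
  | X
  | Z
  | D
  | E

/-- One of the two settings is `X` and the other one is `Z`. -/
def Setting.Complementary (a b : Setting) : Prop :=
  (a = Setting.X ∧ b = Setting.Z) ∨ (a = Setting.Z ∧ b = Setting.X)

/-- A string of questions, one for each of `m` sub-tests: what one player is asked. -/
abbrev Question (m : ℕ) : Type := Fin m → Setting

section Test

variable {HA : Type u} {HB : Type v}
  [NormedAddCommGroup HA] [InnerProductSpace ℂ HA] [CompleteSpace HA]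
  [NormedAddCommGroup HB] [InnerProductSpace ℂ HB] [CompleteSpace HB] {m : ℕ}
  (A : Question m → ProjMeasurement (Answer m) HA)
  (B : Question m → ProjMeasurement (Answer m) HB)

/-- `M'^S_k` for a string `S` of questions to both players, the first `m` for Alice and the last
`m` for Bob: the observable of Alice's `k`-th answer symbol if `k` is one of the first `m`
indices, and the one of the corresponding answer symbol of Bob otherwise. -/
def obs (S : Fin (m + m) → Setting) (k : Fin (m + m)) :
    HilbertTensor HA HB →L[ℂ] HilbertTensor HA HB :=
  Fin.addCases (motive := fun _ => HilbertTensor HA HB →L[ℂ] HilbertTensor HA HB)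
    (fun j => onAlice ((A fun i => S (Fin.castAdd m i)).observable j))
    (fun j => onBob ((B fun i => S (Fin.natAdd m i)).observable j)) k

/-- `X'_k = M'^{X…X}_k`. -/
def opX (k : Fin (m + m)) : HilbertTensor HA HB →L[ℂ] HilbertTensor HA HB :=
  obs A B (fun _ => Setting.X) k

/-- `Z'_k = M'^{Z…Z}_k`. -/
def opZ (k : Fin (m + m)) : HilbertTensor HA HB →L[ℂ] HilbertTensor HA HB :=
  obs A B (fun _ => Setting.Z) k

/-- `D'_k = M'^{D…D}_k`. -/
def opD (k : Fin (m + m)) : HilbertTensor HA HB →L[ℂ] HilbertTensor HA HB :=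
  obs A B (fun _ => Setting.D) k

/-- `E'_k = M'^{E…E}_k`. -/
def opE (k : Fin (m + m)) : HilbertTensor HA HB →L[ℂ] HilbertTensor HA HB :=
  obs A B (fun _ => Setting.E) k

/-- The CHSH operator `X'_i (D'_j - E'_j) + Z'_i (D'_j + E'_j)`. -/
def chshOp (i j : Fin (m + m)) : HilbertTensor HA HB →L[ℂ] HilbertTensor HA HB :=
  opX A B i * (opD A B j - opE A B j) + opZ A B i * (opD A B j + opE A B j)

end Test

/-- The expectation `⟨ψ| T |ψ⟩`; it is a real number when `T` is self-adjoint. -/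
def expectation {H : Type*} [NormedAddCommGroup H] [InnerProductSpace ℂ H]
    (ψ : H) (T : H →L[ℂ] H) : ℝ :=
  (inner ℂ ψ (T ψ)).re

/-- The error bound for `n` qubits, Hamming weight `w` of the exponent of `Z`, and error `ε`. -/
def errorBound (n w : ℕ) (ε : ℝ) : ℝ :=
  √(√(2 * ε) * (9 * (n : ℝ) ^ 2 / 4 + (3 + (2 : ℝ) ^ (5 / 4 : ℝ)) * n / 2)) +
  √(√(2 * ε) * (9 * (n : ℝ) ^ 2 / 8
      + n * (5 * (w : ℝ) / 2 - 1 / 4 + 1 / (2 : ℝ) ^ (3 / 4 : ℝ))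
      + w * ((2 : ℝ) ^ (1 / 4 : ℝ) - 1 / 2)))

end ParallelSelfTest

end

/-!
The players' observables `X' k` and `Z' k` are shown to satisfy the Pauli relations approximately
on `ψ'`; the circuit that swaps the untrusted qubits with fresh ones then extracts the ideal state.
Throughout, `η = √(2 ε)` and `n = 2 m`.

*Relations.* A correlation `1 - ε` of two observables means that they differ by at most `η` on the
state (`norm_sub_le_of_correlation`), and the CHSH value `2 √2 - ε` bounds the anticommutator of
`X' k` and `Z' k` on the state by `2 · 2^(1/4) η`, because the square of the CHSH operator is
`4 + [D, E] [X, Z]` (`norm_anticommutator_le`). What remains is that `Z' k` and `X' j` of the same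
player almost commute for `j ≠ k`. These come from different questions, but the *other* player,
when asked `X` in sub-test `k` and `Z` in all others, holds commuting observables that act on `ψ'`
like `Z' k` and like all the `X' j` with `j ≠ k` (`Shadowed`). Moving factors to the other player
and back gives, for the products over a whole bit string,
`‖Z' ^ t X' ^ q ψ' - (-1) ^ (q ⬝ t) X' ^ q Z' ^ t ψ'‖ ≤ |t| g` with
`g = (3 m - 2 + 2 · 2^(1/4)) η` (`Shadowed.norm_bitPow_Z_bitPow_X_sub_le`).

*Extraction.* The isometry is `φ ↦ ∑ u, X' ^ u P_u φ ⊗ |u⟩`, where `P_u` projects on the joint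
eigenspace of the `Z' k` with signs `(-1) ^ u_k`, that is, `P_u φ` is the Fourier transform of
`t ↦ Z' ^ t φ` on `(ℤ/2)^n`. Parseval's identity turns the squared distance between the extraction
of `φ` and `X ^ q Z ^ p` applied to the extraction of `ψ'` into the average over `t` of
`‖Z' ^ t φ - (-1) ^ (q ⬝ t) X' ^ q Z' ^ (t + p) ψ'‖ ^ 2` (`sum_norm_sq_extract_sub`).
With `φ = X' ^ q Z' ^ p ψ'` the relations bound this distance by `(|p| + n) g`. With `φ = ± ψ'` and
`X ^ q Z ^ p` a stabilizer of the ideal state they bound it by `n (g + η)`; since the projection on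
the ideal state is the average of its stabilizer group, the extraction of `ψ'` is then within
`n (g + η)` of a product `junk ⊗ idealState` (`exists_junk`).

*Constants.* The total distance `D` is at most `K η` for an explicit `K`, and also at most `2`,
so `D ^ 2 ≤ 2 K η ≤ errorBound ^ 2` (`le_errorBound`).
-/

namespace ParallelSelfTest

/-! ### Bit strings and characters -/

theorem eq_zero_or_one (a : ZMod 2) : a = 0 ∨ a = 1 := by
  revert a; decide

theorem hammingNorm_add_single {n : ℕ} {t : BitString n} {k : Fin n} (hk : t k = 0) :
    hammingNorm (t + Pi.single k 1) = hammingNorm t + 1 := by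
  have : Finset.univ.filter (fun j => (t + Pi.single k 1 : BitString n) j ≠ 0) =
      insert k (Finset.univ.filter fun j => t j ≠ 0) := by
    ext j
    by_cases hj : j = k
    · subst hj; simp [hk]
    · simp [hj]
  rw [hammingNorm, hammingNorm, this, Finset.card_insert_of_notMem (by simp [hk])]

/-- Every bit string is reached from `0` by setting one vanishing bit after another. -/
theorem BitString.induction {n : ℕ} {P : BitString n → Prop} (zero : P 0)
    (set_bit : ∀ t k, t k = 0 → P t → P (t + Pi.single k 1)) (t : BitString n) : P t := by
  induction h : hammingNorm t generalizing t with
  | zero => rwa [hammingNorm_eq_zero.1 h]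
  | succ w ih =>
    obtain ⟨k, hk⟩ : ∃ k, t k ≠ 0 := by
      by_contra! h0
      simp [show t = 0 from funext h0] at h
    have h2 : t = Function.update t k 0 + Pi.single k 1 := by
      ext j
      by_cases hj : j = k
      · subst hj; simp [(eq_zero_or_one _).resolve_left hk]
      · simp [hj]
    rw [h2] at h ⊢
    rw [hammingNorm_add_single (by simp)] at h
    exact set_bit _ _ (by simp) (ih _ (by omega))

theorem hammingNorm_le {n : ℕ} (t : BitString n) : hammingNorm t ≤ n := by
  simpa using hammingNorm_le_card_fintype (x := t)

/-- Alice's half of a string of `m + m` bits. -/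
abbrev BitString.left {m : ℕ} (t : BitString (m + m)) : BitString m := fun k => t (Fin.castAdd m k)

/-- Bob's half of a string of `m + m` bits. -/
abbrev BitString.right {m : ℕ} (t : BitString (m + m)) : BitString m := fun k => t (Fin.natAdd m k)

theorem hammingNorm_left_add_right {m : ℕ} (t : BitString (m + m)) :
    hammingNorm t.left + hammingNorm t.right = hammingNorm t := by
  simp only [hammingNorm, Finset.card_filter, Fin.sum_univ_add]

theorem add_self {n : ℕ} (t : BitString n) : t + t = 0 :=
  funext fun k => CharTwo.add_self_eq_zero (t k)

/-- The sign `(-1) ^ a`. -/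
def sgn (a : ZMod 2) : ℂ := (-1) ^ a.val

@[simp] theorem sgn_zero : sgn 0 = 1 := by simp [sgn]

@[simp] theorem sgn_one : sgn 1 = -1 := by simp [sgn, ZMod.val_one]

theorem sgn_add (a b : ZMod 2) : sgn (a + b) = sgn a * sgn b := by
  rcases eq_zero_or_one a with rfl | rfl <;> rcases eq_zero_or_one b with rfl | rfl <;>
    simp [show (1 + 1 : ZMod 2) = 0 from rfl]

theorem sgn_mul_self (a : ZMod 2) : sgn a * sgn a = 1 := by
  rw [← sgn_add, CharTwo.add_self_eq_zero, sgn_zero]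

@[simp] theorem norm_sgn (a : ZMod 2) : ‖sgn a‖ = 1 := by simp [sgn]

@[simp] theorem conj_sgn (a : ZMod 2) : (starRingEnd ℂ) (sgn a) = sgn a := by simp [sgn]

theorem sgn_sum {ι : Type*} (s : Finset ι) (f : ι → ZMod 2) :
    sgn (∑ i ∈ s, f i) = ∏ i ∈ s, sgn (f i) := by
  classical
  induction s using Finset.induction_on with
  | empty => simp
  | insert i s hi ih => rw [Finset.sum_insert hi, Finset.prod_insert hi, sgn_add, ih]

theorem sgn_mul (a b : ZMod 2) : sgn (a * b) = (-1) ^ (a.val * b.val) := by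
  rcases eq_zero_or_one a with rfl | rfl <;> rcases eq_zero_or_one b with rfl | rfl <;>
    simp [ZMod.val_one]

theorem dotProduct_left_add_right {m : ℕ} (s t : BitString (m + m)) :
    s ⬝ᵥ t = s.left ⬝ᵥ t.left + s.right ⬝ᵥ t.right := by
  simp only [dotProduct, Fin.sum_univ_add]

/-- Orthogonality of the characters of `(ℤ/2)^n`. -/
theorem sum_sgn_dotProduct {n : ℕ} (t : BitString n) :
    ∑ u : BitString n, sgn (u ⬝ᵥ t) = if t = 0 then (2 : ℂ) ^ n else 0 := by
  split_ifs with h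
  · simp [h]
  · obtain ⟨k, hk⟩ : ∃ k, t k ≠ 0 := by
      by_contra! h0
      exact h (funext h0)
    have hk1 : t k = 1 := (eq_zero_or_one _).resolve_left hk
    have h1 : ∑ u : BitString n, sgn (u ⬝ᵥ t) = ∑ u : BitString n, -sgn (u ⬝ᵥ t) := by
      refine Fintype.sum_equiv (Equiv.addRight (Pi.single k 1)) _ _ fun u => ?_
      simp [add_dotProduct, sgn_add, hk1]
    rw [Finset.sum_neg_distrib] at h1
    exact self_eq_neg.1 h1

section Fourier

variable {H : Type*} [NormedAddCommGroup H] [InnerProductSpace ℂ H] {n : ℕ}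

/-- The Fourier transform on `(ℤ/2)^n`, normalised by `2⁻ⁿ`, of a vector-valued function. -/
noncomputable def fourier (f : BitString n → H) (u : BitString n) : H :=
  ((2 : ℂ) ^ n)⁻¹ • ∑ t, sgn (u ⬝ᵥ t) • f t

theorem re_inner_self (x : H) : (inner ℂ x x).re = ‖x‖ ^ 2 :=
  inner_self_eq_norm_sq (𝕜 := ℂ) x

/-- Parseval's identity. -/
theorem sum_norm_sq_fourier (f : BitString n → H) :
    ∑ u, ‖fourier f u‖ ^ 2 = ((2 : ℝ) ^ n)⁻¹ * ∑ t, ‖f t‖ ^ 2 := by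
  have key : ∑ u, inner ℂ (fourier f u) (fourier f u) =
      ((2 : ℂ) ^ n)⁻¹ * ∑ t, inner ℂ (f t) (f t) := by
    have h1 : ∀ u, inner ℂ (fourier f u) (fourier f u) = ((2 : ℂ) ^ n)⁻¹ * ((2 : ℂ) ^ n)⁻¹ *
        ∑ t, ∑ s, sgn (u ⬝ᵥ (s + t)) * inner ℂ (f s) (f t) := fun u => by
      simp only [fourier, inner_smul_left, inner_smul_right, sum_inner, inner_sum, conj_sgn,
        dotProduct_add, sgn_add, Finset.mul_sum]
      refine Finset.sum_congr rfl fun t _ => Finset.sum_congr rfl fun s _ => ?_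
      simp only [map_inv₀, map_pow, map_ofNat]
      ring
    simp only [h1]
    rw [← Finset.mul_sum, Finset.sum_comm]
    simp_rw [Finset.sum_comm (s := (Finset.univ : Finset (BitString n)))
      (t := (Finset.univ : Finset (BitString n))) (f := fun u s => sgn (u ⬝ᵥ (s + _)) * _)]
    simp_rw [← Finset.sum_mul, sum_sgn_dotProduct]
    have h2 : ∀ s t : BitString n, s + t = 0 ↔ s = t := fun s t => by
      rw [← add_self t, add_left_inj]
    simp only [h2, ite_mul, zero_mul, Finset.sum_ite_eq', Finset.mem_univ, if_true]
    rw [← Finset.mul_sum]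
    field_simp
  have hc : ((2 : ℂ) ^ n)⁻¹ = (((2 : ℝ) ^ n)⁻¹ : ℝ) := by push_cast; rfl
  have := congrArg Complex.re key
  rw [hc, Complex.re_ofReal_mul, Complex.re_sum, Complex.re_sum] at this
  simpa only [re_inner_self] using this

end Fourier

/-! ### Operators raised to bit strings -/

/-- The `X k` are involutions that commute with each other, so that `t ↦ X ^ t` is a representation
of `(ℤ/2)^n`. -/
structure CommutingInvolutions {M : Type*} [Monoid M] {n : ℕ} (X : Fin n → M) : Prop where
  commute : ∀ j k, Commute (X j) (X k)
  mul_self : ∀ k, X k * X k = 1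

section BitPow

variable {M : Type*} [Monoid M] {n : ℕ}

@[simp] theorem bitPow_zero (X : Fin n → M) : bitPow X 0 = 1 := by
  simp [bitPow]

theorem bitPow_succ (X : Fin (n + 1) → M) (t : BitString (n + 1)) :
    bitPow X t = X 0 ^ (t 0).val * bitPow (fun k => X k.succ) fun k => t k.succ := by
  simp [bitPow, List.ofFn_succ]

theorem commute_bitPow {X : Fin n → M} {a : M} (h : ∀ k, Commute a (X k)) (t : BitString n) :
    Commute a (bitPow X t) := by
  refine Commute.list_prod_right _ _ fun x hx => ?_
  obtain ⟨k, rfl⟩ := List.mem_ofFn.1 hx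
  exact (h k).pow_right _

theorem bitPow_induction {X : Fin n → M} {p : M → Prop} (hmul : ∀ a b, p a → p b → p (a * b))
    (hone : p 1) (hX : ∀ k, p (X k)) (t : BitString n) : p (bitPow X t) := by
  refine List.prod_induction p hmul hone fun x hx => ?_
  obtain ⟨k, rfl⟩ := List.mem_ofFn.1 hx
  rcases eq_zero_or_one (t k) with h | h
  · simpa [h] using hone
  · simpa [h, ZMod.val_one] using hX k

theorem bitPow_single (X : Fin n → M) (k : Fin n) : bitPow X (Pi.single k 1) = X k := by
  induction n with
  | zero => exact k.elim0
  | succ n ih =>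
    rw [bitPow_succ]
    refine Fin.cases ?_ (fun k => ?_) k
    · have : (fun j : Fin n => (Pi.single 0 1 : BitString (n + 1)) j.succ) = 0 := by
        ext j; simp
      rw [this]
      simp [ZMod.val_one]
    · have : (fun j : Fin n => (Pi.single k.succ 1 : BitString (n + 1)) j.succ) =
          Pi.single k 1 := by
        ext j; simp [Pi.single_apply]
      rw [this, ih]
      simp

theorem bitPow_left_mul_right {m : ℕ} (X : Fin (m + m) → M) (t : BitString (m + m)) :
    bitPow X t = bitPow (fun k => X (Fin.castAdd m k)) t.left *
      bitPow (fun k => X (Fin.natAdd m k)) t.right := by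
  rw [bitPow, List.ofFn_add, List.prod_append]
  rfl

namespace CommutingInvolutions

theorem bitPow_add {X : Fin n → M} (hX : CommutingInvolutions X) (s t : BitString n) :
    bitPow X (s + t) = bitPow X s * bitPow X t := by
  induction n with
  | zero => simp [bitPow]
  | succ n ih =>
    have hX' : CommutingInvolutions fun k : Fin n => X k.succ :=
      ⟨fun j k => hX.commute _ _, fun k => hX.mul_self _⟩
    have h0 : ∀ a b : ZMod 2, X 0 ^ (a + b).val = X 0 ^ a.val * X 0 ^ b.val := fun a b => by
      rcases eq_zero_or_one a with rfl | rfl <;> rcases eq_zero_or_one b with rfl | rfl <;>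
        simp [ZMod.val_one, hX.mul_self, show (1 + 1 : ZMod 2) = 0 from rfl]
    have h1 := ih hX' (fun k => s k.succ) (fun k => t k.succ)
    have h2 : Commute (X 0 ^ (t 0).val) (bitPow (fun k => X k.succ) fun k => s k.succ) :=
      commute_bitPow (fun k => (hX.commute _ _).pow_left _) _
    rw [bitPow_succ, bitPow_succ, bitPow_succ, Pi.add_apply, h0]
    change _ * bitPow _ ((fun k => s k.succ) + fun k => t k.succ) = _
    rw [h1, mul_assoc, mul_assoc, ← mul_assoc (X 0 ^ (t 0).val), h2.eq, mul_assoc]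

theorem bitPow_add_single {X : Fin n → M} (hX : CommutingInvolutions X) (t : BitString n)
    (k : Fin n) : bitPow X (t + Pi.single k 1) = bitPow X t * X k := by
  rw [hX.bitPow_add, bitPow_single]

end CommutingInvolutions

end BitPow

section Norm

variable {H : Type*} [NormedAddCommGroup H] [NormedSpace ℂ H] {n : ℕ}

theorem norm_bitPow_apply {X : Fin n → H →L[ℂ] H} (hX : ∀ k x, ‖X k x‖ = ‖x‖) (t : BitString n)
    (x : H) : ‖bitPow X t x‖ = ‖x‖ := by
  revert x
  refine bitPow_induction (p := fun T : H →L[ℂ] H => ∀ x, ‖T x‖ = ‖x‖) (fun a b ha hb x => ?_)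
    (fun x => rfl) hX t
  rw [mul_apply_eq_comp, ha, hb]

end Norm

/-! ### Pauli operators and the ideal state -/

theorem commutingInvolutions_pauliX (n : ℕ) :
    CommutingInvolutions (pauliX : Fin n → Module.End ℂ (Qubits n)) where
  commute j k := by
    ext f u
    simp [pauliX, add_right_comm]
  mul_self k := by
    ext f u
    simp [pauliX, add_assoc, add_self]

theorem commutingInvolutions_pauliZ (n : ℕ) :
    CommutingInvolutions (pauliZ : Fin n → Module.End ℂ (Qubits n)) where
  commute j k := by
    ext f u
    simp [pauliZ, mul_left_comm]
  mul_self k := by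
    ext f u
    have := sgn_mul_self (u k)
    simp only [sgn] at this
    simp [pauliZ, ← mul_assoc, this]

theorem bitPow_pauliX_apply {n : ℕ} (q u : BitString n) (f : Qubits n) :
    bitPow pauliX q f u = f (u + q) := by
  induction q using BitString.induction generalizing f with
  | zero => simp
  | set_bit q k hk ih =>
    rw [(commutingInvolutions_pauliX n).bitPow_add_single, Module.End.mul_apply, ih]
    simp [pauliX, add_assoc]

theorem bitPow_pauliZ_apply {n : ℕ} (p u : BitString n) (f : Qubits n) :
    bitPow pauliZ p f u = sgn (p ⬝ᵥ u) * f u := by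
  induction p using BitString.induction generalizing f with
  | zero => simp
  | set_bit q k hk ih =>
    rw [(commutingInvolutions_pauliZ n).bitPow_add_single, Module.End.mul_apply, ih]
    rw [add_dotProduct, sgn_add, mul_assoc]
    simp [pauliZ, sgn]

theorem idealState_apply {m : ℕ} (u : BitString (m + m)) :
    idealState m u = ((2 : ℂ) ^ m)⁻¹ * sgn (u.left ⬝ᵥ u.right) := by
  simp only [idealState, dotProduct, sgn_sum, sgn_mul, Finset.prod_mul_distrib]
  simp only [Finset.prod_const, Finset.card_univ, Fintype.card_fin, one_div, inv_pow]

/-! ### Observables and the relations forced by the test -/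

section Observable

variable {H : Type*} [NormedAddCommGroup H] [InnerProductSpace ℂ H]

/-- A `±1`-valued observable: a self-adjoint involution. -/
structure IsObservable (T : H →L[ℂ] H) : Prop where
  symm : ∀ x y, inner ℂ (T x) y = inner ℂ x (T y)
  mul_self : T * T = 1

theorem _root_.Commute.apply_comm {S T : H →L[ℂ] H} (h : Commute S T) (x : H) :
    S (T x) = T (S x) :=
  congrArg (fun U : H →L[ℂ] H => U x) h.eq

namespace IsObservable

theorem apply_apply {T : H →L[ℂ] H} (hT : IsObservable T) (x : H) : T (T x) = x :=
  congrArg (fun U : H →L[ℂ] H => U x) hT.mul_self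

theorem norm_apply {T : H →L[ℂ] H} (hT : IsObservable T) (x : H) : ‖T x‖ = ‖x‖ := by
  rw [← sq_eq_sq₀ (norm_nonneg _) (norm_nonneg _), ← re_inner_self, ← re_inner_self, hT.symm,
    hT.apply_apply]

end IsObservable

theorem expectation_le_norm (ψ : H) (hψ : ‖ψ‖ = 1) (T : H →L[ℂ] H) :
    expectation ψ T ≤ ‖T ψ‖ := by
  refine (Complex.re_le_norm _).trans ((norm_inner_le_norm _ _).trans ?_)
  rw [hψ, one_mul]

/-- Two observables that are almost perfectly correlated act almost alike. -/
theorem norm_sub_le_of_correlation {ψ : H} (hψ : ‖ψ‖ = 1) {S T : H →L[ℂ] H} (hS : IsObservable S)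
    (hT : IsObservable T) {ε : ℝ} (h : expectation ψ (S * T) ≥ 1 - ε) :
    ‖S ψ - T ψ‖ ≤ √(2 * ε) := by
  refine Real.le_sqrt_of_sq_le ?_
  have h1 := norm_sub_sq (𝕜 := ℂ) (S ψ) (T ψ)
  rw [hS.norm_apply, hT.norm_apply, hS.symm, hψ] at h1
  change (inner ℂ ψ (S (T ψ))).re ≥ _ at h
  rw [RCLike.re_eq_complex_re] at h1
  linarith

theorem two_rpow_quarter_sq : ((2 : ℝ) ^ (1 / 4 : ℝ)) ^ 2 = √2 := by
  rw [← Real.rpow_natCast, ← Real.rpow_mul (by norm_num), Real.sqrt_eq_rpow]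
  norm_num

theorem chsh_mul_self {R : Type*} [Ring R] {X Z D E : R} (hX : X * X = 1) (hZ : Z * Z = 1)
    (hD : D * D = 1) (hE : E * E = 1) (hXD : Commute X D) (hXE : Commute X E) (hZD : Commute Z D)
    (hZE : Commute Z E) :
    (X * (D - E) + Z * (D + E)) * (X * (D - E) + Z * (D + E)) =
      4 + (D * E - E * D) * (X * Z - Z * X) := by
  have h1 : Commute X (D - E) := hXD.sub_right hXE
  have h2 : Commute X (D + E) := hXD.add_right hXE
  have h3 : Commute Z (D - E) := hZD.sub_right hZE
  have h4 : Commute Z (D + E) := hZD.add_right hZE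
  have hc : Commute (X * Z - Z * X) (D * E - E * D) :=
    (((hXD.mul_left hZD).mul_right (hXE.mul_left hZE)).sub_right
      ((hXE.mul_left hZE).mul_right (hXD.mul_left hZD))).sub_left
    (((hZD.mul_left hXD).mul_right (hZE.mul_left hXE)).sub_right
      ((hZE.mul_left hXE).mul_right (hZD.mul_left hXD)))
  have e5 : (D - E) * (D - E) = 2 - (D * E + E * D) := by
    rw [sub_mul, mul_sub, mul_sub, hD, hE, ← one_add_one_eq_two]; abel
  have e6 : (D + E) * (D + E) = 2 + (D * E + E * D) := by
    rw [add_mul, mul_add, mul_add, hD, hE, ← one_add_one_eq_two]; abel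
  have e7 : (D - E) * (D + E) = D * E - E * D := by
    rw [sub_mul, mul_add, mul_add, hD, hE]; abel
  have e8 : (D + E) * (D - E) = -(D * E - E * D) := by
    rw [add_mul, mul_sub, mul_sub, hD, hE]; abel
  rw [add_mul, mul_add (X * (D - E)), mul_add (Z * (D + E)), h1.symm.mul_mul_mul_comm,
    h3.symm.mul_mul_mul_comm, h2.symm.mul_mul_mul_comm, h4.symm.mul_mul_mul_comm, hX, hZ, e5, e6,
    e7, e8, ← hc.eq, sub_mul, mul_neg, one_mul, one_mul, show (4 : R) = 2 + 2 by norm_num]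
  abel

/-- Almost maximal violation of the CHSH inequality forces `X` and `Z` to almost anticommute. -/
theorem norm_anticommutator_le {ψ : H} (hψ : ‖ψ‖ = 1) {X Z D E : H →L[ℂ] H}
    (hX : IsObservable X) (hZ : IsObservable Z) (hD : IsObservable D) (hE : IsObservable E)
    (hXD : Commute X D) (hXE : Commute X E) (hZD : Commute Z D) (hZE : Commute Z E) {ε : ℝ}
    (h : expectation ψ (X * (D - E) + Z * (D + E)) ≥ 2 * √2 - ε) :
    ‖X (Z ψ) + Z (X ψ)‖ ≤ 2 * (2 : ℝ) ^ (1 / 4 : ℝ) * √(2 * ε) := by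
  set K := X * (D - E) + Z * (D + E) with hK
  have h2 : √2 * √2 = 2 := Real.mul_self_sqrt (by norm_num)
  have h0 : 0 < √2 := by positivity
  -- the commutator and the anticommutator are complementary
  have hpar : ‖X (Z ψ) + Z (X ψ)‖ ^ 2 + ‖X (Z ψ) - Z (X ψ)‖ ^ 2 = 4 := by
    have := parallelogram_law_with_norm ℂ (X (Z ψ)) (Z (X ψ))
    simp only [hX.norm_apply, hZ.norm_apply, hψ] at this
    linarith
  -- the square of the CHSH operator is governed by the commutator
  have hsq : ‖K ψ‖ ^ 2 ≤ 4 + 2 * ‖X (Z ψ) - Z (X ψ)‖ := by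
    have hsymm : inner ℂ (K ψ) (K ψ) = inner ℂ ψ (K (K ψ)) := by
      simp only [hK, _root_.add_apply, mul_apply_eq_comp, _root_.sub_apply, inner_add_left,
        inner_sub_left, map_add, map_sub, hX.symm, hZ.symm, hD.symm, hE.symm, inner_add_right,
        inner_sub_right, hXD.apply_comm, hXE.apply_comm, hZD.apply_comm, hZE.apply_comm]
    have hKK : K (K ψ) = (4 : ℂ) • ψ + (D (E (X (Z ψ) - Z (X ψ))) - E (D (X (Z ψ) - Z (X ψ)))) := by
      have := congrArg (fun U : H →L[ℂ] H => U ψ) (chsh_mul_self hX.mul_self hZ.mul_self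
        hD.mul_self hE.mul_self hXD hXE hZD hZE)
      have h4 : (4 : H →L[ℂ] H) ψ = (4 : ℂ) • ψ := by
        rw [show (4 : H →L[ℂ] H) = (4 : ℂ) • 1 by
          rw [ofNat_smul_eq_nsmul, nsmul_eq_mul, mul_one]; norm_num]
        rfl
      simpa only [hK, _root_.add_apply, mul_apply_eq_comp, _root_.sub_apply, h4] using this
    rw [← re_inner_self, hsymm, hKK, inner_add_right, inner_smul_right, Complex.add_re]
    have h5 := expectation_le_norm ψ hψ ((D * E - E * D) * (X * Z - Z * X))
    have h6 : ‖D (E (X (Z ψ) - Z (X ψ))) - E (D (X (Z ψ) - Z (X ψ)))‖ ≤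
        2 * ‖X (Z ψ) - Z (X ψ)‖ := by
      refine (norm_sub_le _ _).trans ?_
      rw [hD.norm_apply, hE.norm_apply, hE.norm_apply, hD.norm_apply, two_mul]
    have h7 := re_inner_self ψ
    rw [hψ] at h7
    have h8 : ((4 : ℂ) * inner ℂ ψ ψ).re = 4 := by
      rw [Complex.mul_re, h7]
      simp
    rw [h8]
    have := h5.trans h6
    exact add_le_add_right this 4
  have he : 2 * √2 - ε ≤ ‖K ψ‖ := h.le.trans (expectation_le_norm ψ hψ K)
  set p := ‖X (Z ψ) - Z (X ψ)‖
  set a := ‖X (Z ψ) + Z (X ψ)‖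
  have hp : 0 ≤ p := norm_nonneg _
  have ha : a ^ 2 ≤ 8 * √2 * ε := by
    by_cases hc : 2 - 2 * √2 * ε ≤ 0
    · nlinarith
    · push Not at hc
      have : 2 - 2 * √2 * ε ≤ p := by
        have : 0 ≤ 2 * √2 - ε := by nlinarith
        have := pow_le_pow_left₀ this he 2
        nlinarith [sq_nonneg ε]
      nlinarith [sq_nonneg ε]
  have hε : 0 ≤ ε := by
    by_contra! hneg
    have : √2 * ε < 0 := by nlinarith
    nlinarith [sq_nonneg a]
  refine le_of_sq_le_sq ?_ (by positivity)
  rw [mul_pow, mul_pow, two_rpow_quarter_sq, Real.sq_sqrt (by positivity)]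
  linarith

end Observable

/-! ### Approximate Pauli relations of one player -/

section OneSide

variable {H : Type*} [NormedAddCommGroup H] [InnerProductSpace ℂ H]

/-- Observables `F k` that commute with each other. -/
structure ObservableFamily {n : ℕ} (F : Fin n → H →L[ℂ] H) : Prop where
  observable : ∀ k, IsObservable (F k)
  commute : ∀ j k, Commute (F j) (F k)

namespace ObservableFamily

variable {n : ℕ} {F G : Fin n → H →L[ℂ] H}

theorem commutingInvolutions (hF : ObservableFamily F) : CommutingInvolutions F :=
  ⟨hF.commute, fun k => (hF.observable k).mul_self⟩

theorem norm_sub_apply (hF : ObservableFamily F) (k : Fin n) (x y : H) :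
    ‖F k x - F k y‖ = ‖x - y‖ := by
  rw [← map_sub, (hF.observable k).norm_apply]

theorem norm_bitPow_apply (hF : ObservableFamily F) (t : BitString n) (x : H) :
    ‖bitPow F t x‖ = ‖x‖ :=
  ParallelSelfTest.norm_bitPow_apply (fun k => (hF.observable k).norm_apply) t x

theorem norm_bitPow_sub_apply (hF : ObservableFamily F) (t : BitString n) (x y : H) :
    ‖bitPow F t x - bitPow F t y‖ = ‖x - y‖ := by
  rw [← map_sub, hF.norm_bitPow_apply]

theorem bitPow_add_apply (hF : ObservableFamily F) (s t : BitString n) (x : H) :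
    bitPow F (s + t) x = bitPow F s (bitPow F t x) := by
  rw [hF.commutingInvolutions.bitPow_add, mul_apply_eq_comp]

theorem bitPow_add_single_apply (hF : ObservableFamily F) (t : BitString n) (k : Fin n) (x : H) :
    bitPow F (t + Pi.single k 1) x = bitPow F t (F k x) := by
  rw [hF.bitPow_add_apply, bitPow_single]

theorem bitPow_bitPow_apply (hF : ObservableFamily F) (t : BitString n) (x : H) :
    bitPow F t (bitPow F t x) = x := by
  rw [← hF.bitPow_add_apply, add_self, bitPow_zero]
  rfl

/-- If the `F j` act on `ψ` almost like the commuting `G j`, then so do their products. -/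
theorem norm_bitPow_sub_bitPow_le (hF : ObservableFamily F) (hG : ObservableFamily G)
    (hFG : ∀ j k, Commute (F j) (G k)) {ψ : H} {η : ℝ} (t : BitString n)
    (h : ∀ j, t j ≠ 0 → ‖F j ψ - G j ψ‖ ≤ η) :
    ‖bitPow F t ψ - bitPow G t ψ‖ ≤ hammingNorm t * η := by
  induction t using BitString.induction with
  | zero => simp
  | set_bit t k hk ih =>
    have h1 : ‖bitPow F t ψ - bitPow G t ψ‖ ≤ hammingNorm t * η := by
      refine ih fun j hj => h j ?_
      have : j ≠ k := by rintro rfl; exact hj hk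
      simpa [this] using hj
    have h2 : ‖F k ψ - G k ψ‖ ≤ η := h k (by simp [hk])
    rw [hammingNorm_add_single hk, hF.bitPow_add_single_apply, hG.bitPow_add_single_apply]
    have e : bitPow F t (G k ψ) = G k (bitPow F t ψ) :=
      ((commute_bitPow (fun j => (hFG j k).symm) t).apply_comm ψ).symm
    have e' : bitPow G t (G k ψ) = G k (bitPow G t ψ) :=
      ((commute_bitPow (fun j => hG.commute k j) t).apply_comm ψ).symm
    have h3 := norm_sub_le_norm_sub_add_norm_sub (bitPow F t (F k ψ)) (bitPow F t (G k ψ))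
      (bitPow G t (G k ψ))
    rw [hF.norm_bitPow_sub_apply, e, e', hG.norm_sub_apply] at h3
    rw [e']
    push_cast
    linarith

end ObservableFamily

/-- The observables `X k` and `Z k` of one player, together with observables of the other player
that shadow them on the state `ψ`: for every `k` the family `R k` acts on `ψ` almost like the
mixed family with `Z k` at `k` and `X j` at every `j ≠ k`, but it consists of commuting observables.
Moreover `X k` and `Z k` almost anticommute on `ψ`. -/
structure Shadowed {m : ℕ} (X Z : Fin m → H →L[ℂ] H) (R : Fin m → Fin m → H →L[ℂ] H) (ψ : H)
    (η α : ℝ) : Prop where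
  family_X : ObservableFamily X
  family_Z : ObservableFamily Z
  family_R : ∀ k, ObservableFamily (R k)
  commute_X : ∀ k j l, Commute (X l) (R k j)
  commute_Z : ∀ k j l, Commute (Z l) (R k j)
  approx_X : ∀ k j, j ≠ k → ‖X j ψ - R k j ψ‖ ≤ η
  approx_Z : ∀ k, ‖Z k ψ - R k k ψ‖ ≤ η
  anticommute : ∀ k, ‖X k (Z k ψ) + Z k (X k ψ)‖ ≤ α

namespace Shadowed

variable {m : ℕ} {X Z : Fin m → H →L[ℂ] H} {R : Fin m → Fin m → H →L[ℂ] H} {ψ : H} {η α : ℝ}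

theorem norm_bitPow_sub_shadow_le (h : Shadowed X Z R ψ η α) {q : BitString m} {k : Fin m}
    (hq : q k = 0) : ‖bitPow X q ψ - bitPow (R k) q ψ‖ ≤ hammingNorm q * η :=
  h.family_X.norm_bitPow_sub_bitPow_le (h.family_R k) (fun j l => h.commute_X k l j) q fun j hj =>
    h.approx_X k j (by rintro rfl; exact hj hq)

/-- A single `Z k` passes through `X ^ q` when `q` vanishes at `k`: replaced by their shadows, the
factors commute. -/
theorem norm_Z_bitPow_X_sub_le (h : Shadowed X Z R ψ η α) {q : BitString m} {k : Fin m}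
    (hq : q k = 0) :
    ‖Z k (bitPow X q ψ) - bitPow X q (R k k ψ)‖ ≤ (2 * hammingNorm q + 1) * η := by
  have h1 := h.norm_bitPow_sub_shadow_le hq
  have h2 := norm_sub_le_norm_sub_add_norm_sub (Z k (bitPow X q ψ)) (Z k (bitPow (R k) q ψ))
    (bitPow X q (R k k ψ))
  have h3 := norm_sub_le_norm_sub_add_norm_sub (bitPow (R k) q (Z k ψ))
    (bitPow (R k) q (R k k ψ)) (bitPow X q (R k k ψ))
  have e1 : Z k (bitPow (R k) q ψ) = bitPow (R k) q (Z k ψ) :=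
    (commute_bitPow (fun j => h.commute_Z k j k) q).apply_comm ψ
  have e2 : bitPow (R k) q (R k k ψ) = R k k (bitPow (R k) q ψ) :=
    ((commute_bitPow (fun j => (h.family_R k).commute k j) q).apply_comm ψ).symm
  have e3 : bitPow X q (R k k ψ) = R k k (bitPow X q ψ) :=
    ((commute_bitPow (fun j => (h.commute_X k k j).symm) q).apply_comm ψ).symm
  rw [h.family_Z.norm_sub_apply, e1] at h2
  rw [(h.family_R k).norm_bitPow_sub_apply, e2, e3, (h.family_R k).norm_sub_apply,
    norm_sub_rev (bitPow (R k) q ψ)] at h3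
  rw [e3] at h2 ⊢
  linarith [h.approx_Z k]

/-- A single `Z k` changes the sign when it passes through `X ^ q * X k`. -/
theorem norm_Z_bitPow_X_add_le (h : Shadowed X Z R ψ η α) {q : BitString m} {k : Fin m}
    (hq : q k = 0) :
    ‖Z k (bitPow X q (X k ψ)) + bitPow X q (X k (R k k ψ))‖ ≤
      (2 * hammingNorm q + 1) * η + α := by
  have h1 := h.norm_bitPow_sub_shadow_le hq
  set S := bitPow (R k) q
  set T := bitPow X q
  have cTX (x : H) : T (X k x) = X k (T x) :=
    ((commute_bitPow (fun j => h.family_X.commute k j) q).apply_comm x).symm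
  have cSX (x : H) : S (X k x) = X k (S x) :=
    ((commute_bitPow (fun j => h.commute_X k j k) q).apply_comm x).symm
  have cSZ (x : H) : S (Z k x) = Z k (S x) :=
    ((commute_bitPow (fun j => h.commute_Z k j k) q).apply_comm x).symm
  have cTR (x : H) : T (R k k x) = R k k (T x) :=
    ((commute_bitPow (fun j => (h.commute_X k k j).symm) q).apply_comm x).symm
  have cSR (x : H) : S (R k k x) = R k k (S x) :=
    ((commute_bitPow (fun j => (h.family_R k).commute k j) q).apply_comm x).symm
  have e1 : ‖Z k (T (X k ψ)) - S (Z k (X k ψ))‖ = ‖T ψ - S ψ‖ := by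
    rw [cSZ, cSX, cTX, h.family_Z.norm_sub_apply, h.family_X.norm_sub_apply]
  have e2 : ‖S (Z k (X k ψ)) + S (X k (Z k ψ))‖ = ‖X k (Z k ψ) + Z k (X k ψ)‖ := by
    rw [← map_add, (h.family_R k).norm_bitPow_apply, add_comm]
  have e3 : ‖S (X k (Z k ψ)) - S (X k (R k k ψ))‖ = ‖Z k ψ - R k k ψ‖ := by
    rw [(h.family_R k).norm_bitPow_sub_apply, h.family_X.norm_sub_apply]
  have e4 : ‖S (X k (R k k ψ)) - T (X k (R k k ψ))‖ = ‖T ψ - S ψ‖ := by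
    rw [cSX, cTX, cSR, cTR, h.family_X.norm_sub_apply, (h.family_R k).norm_sub_apply,
      norm_sub_rev]
  have e5 : Z k (T (X k ψ)) + T (X k (R k k ψ)) = (Z k (T (X k ψ)) - S (Z k (X k ψ))) +
      (S (Z k (X k ψ)) + S (X k (Z k ψ))) - (S (X k (Z k ψ)) - S (X k (R k k ψ))) -
      (S (X k (R k k ψ)) - T (X k (R k k ψ))) := by abel
  rw [e5]
  have h6 := norm_sub_le ((Z k (T (X k ψ)) - S (Z k (X k ψ))) +
      (S (Z k (X k ψ)) + S (X k (Z k ψ))) - (S (X k (Z k ψ)) - S (X k (R k k ψ))))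
      (S (X k (R k k ψ)) - T (X k (R k k ψ)))
  have h7 := norm_sub_le ((Z k (T (X k ψ)) - S (Z k (X k ψ))) +
      (S (Z k (X k ψ)) + S (X k (Z k ψ)))) (S (X k (Z k ψ)) - S (X k (R k k ψ)))
  have h8 := norm_add_le (Z k (T (X k ψ)) - S (Z k (X k ψ)))
      (S (Z k (X k ψ)) + S (X k (Z k ψ)))
  linarith [h.approx_Z k, h.anticommute k]

/-- The sign with which `Z k` passes through `X ^ q` is `(-1) ^ q_k`; at most `m - 1` factors of
`X ^ q` have to be moved to the other player and back. -/
theorem norm_Z_bitPow_X_sub_sgn_le (h : Shadowed X Z R ψ η α) (hη : 0 ≤ η) (hα : 0 ≤ α)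
    (q : BitString m) (k : Fin m) :
    ‖Z k (bitPow X q ψ) - sgn (q k) • bitPow X q (R k k ψ)‖ ≤ (2 * m - 1) * η + α := by
  rcases eq_zero_or_one (q k) with hq | hq
  · have h1 := h.norm_Z_bitPow_X_sub_le hq
    have h2 : ((hammingNorm q + 1 : ℕ) : ℝ) ≤ m := by
      rw [← hammingNorm_add_single hq]
      exact_mod_cast hammingNorm_le _
    push_cast at h2
    rw [hq, sgn_zero, one_smul]
    nlinarith
  · have h0 : q = (q + Pi.single k 1) + Pi.single k 1 := by
      rw [add_assoc, add_self, add_zero]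
    have hq' : (q + Pi.single k 1 : BitString m) k = 0 := by
      simp [hq, CharTwo.add_self_eq_zero]
    generalize q + Pi.single k 1 = q' at h0 hq'
    have h1 := h.norm_Z_bitPow_X_add_le hq'
    have h2 : ((hammingNorm q' + 1 : ℕ) : ℝ) ≤ m := by
      rw [← hammingNorm_add_single hq']
      exact_mod_cast hammingNorm_le _
    push_cast at h2
    rw [hq, sgn_one, neg_one_smul, sub_neg_eq_add, h0, h.family_X.bitPow_add_single_apply,
      h.family_X.bitPow_add_single_apply]
    nlinarith

/-- The factors `Z k` of `Z ^ t` pass through `X ^ q` one by one, each one being left with the other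
player as `R k k` until it reaches `ψ`; so a factor costs one passage and one return. -/
theorem norm_bitPow_Z_bitPow_X_sub_le_two_mul (h : Shadowed X Z R ψ η α) (hη : 0 ≤ η) (hα : 0 ≤ α)
    (q t : BitString m) :
    ‖bitPow Z t (bitPow X q ψ) - sgn (q ⬝ᵥ t) • bitPow X q (bitPow Z t ψ)‖ ≤
      hammingNorm t * (2 * m * η + α) := by
  induction t using BitString.induction with
  | zero => simp
  | set_bit t k hk ih =>
    have h1 := h.norm_Z_bitPow_X_sub_sgn_le hη hα q k
    rw [h.family_Z.bitPow_add_single_apply, h.family_Z.bitPow_add_single_apply,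
      hammingNorm_add_single hk, dotProduct_add, dotProduct_single, mul_one, sgn_add]
    have cX (x : H) : bitPow X q (R k k x) = R k k (bitPow X q x) :=
      ((commute_bitPow (fun j => (h.commute_X k k j).symm) q).apply_comm x).symm
    have cZ (x : H) : bitPow Z t (R k k x) = R k k (bitPow Z t x) :=
      ((commute_bitPow (fun j => (h.commute_Z k k j).symm) t).apply_comm x).symm
    have e1 : ‖bitPow Z t (Z k (bitPow X q ψ)) - sgn (q k) • R k k (bitPow Z t (bitPow X q ψ))‖ =
        ‖Z k (bitPow X q ψ) - sgn (q k) • bitPow X q (R k k ψ)‖ := by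
      rw [← cZ, ← cX, ← map_smul, h.family_Z.norm_bitPow_sub_apply]
    have e2 : ‖sgn (q k) • R k k (bitPow Z t (bitPow X q ψ)) -
        sgn (q k) • R k k (sgn (q ⬝ᵥ t) • bitPow X q (bitPow Z t ψ))‖ =
        ‖bitPow Z t (bitPow X q ψ) - sgn (q ⬝ᵥ t) • bitPow X q (bitPow Z t ψ)‖ := by
      rw [← smul_sub, norm_smul, norm_sgn, one_mul, (h.family_R k).norm_sub_apply]
    have e3 : ‖sgn (q k) • R k k (sgn (q ⬝ᵥ t) • bitPow X q (bitPow Z t ψ)) -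
        (sgn (q ⬝ᵥ t) * sgn (q k)) • bitPow X q (bitPow Z t (Z k ψ))‖ = ‖Z k ψ - R k k ψ‖ := by
      rw [map_smul, smul_smul, mul_comm (sgn (q k)), ← cX, ← cZ, ← smul_sub, norm_smul, norm_mul,
        norm_sgn, norm_sgn, h.family_X.norm_bitPow_sub_apply, h.family_Z.norm_bitPow_sub_apply,
        norm_sub_rev, one_mul, one_mul]
    have h2 := norm_sub_le_norm_sub_add_norm_sub (bitPow Z t (Z k (bitPow X q ψ)))
      (sgn (q k) • R k k (bitPow Z t (bitPow X q ψ)))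
      ((sgn (q ⬝ᵥ t) * sgn (q k)) • bitPow X q (bitPow Z t (Z k ψ)))
    have h3 := norm_sub_le_norm_sub_add_norm_sub (sgn (q k) • R k k (bitPow Z t (bitPow X q ψ)))
      (sgn (q k) • R k k (sgn (q ⬝ᵥ t) • bitPow X q (bitPow Z t ψ)))
      ((sgn (q ⬝ᵥ t) * sgn (q k)) • bitPow X q (bitPow Z t (Z k ψ)))
    rw [e1] at h2
    rw [e2, e3] at h3
    push_cast
    linarith [h.approx_Z k]

/-- For a single pair the relation costs only the anticommutator. -/
theorem norm_bitPow_Z_bitPow_X_sub_le_of_eq_one (h : Shadowed X Z R ψ η α) (hm : m = 1)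
    (q t : BitString m) :
    ‖bitPow Z t (bitPow X q ψ) - sgn (q ⬝ᵥ t) • bitPow X q (bitPow Z t ψ)‖ ≤
      hammingNorm t * α := by
  subst hm
  have hs (s : BitString 1) : s = 0 ∨ s = Pi.single 0 1 := by
    rcases eq_zero_or_one (s 0) with h0 | h0
    · exact Or.inl (funext fun k => by rw [Subsingleton.elim k 0, h0]; rfl)
    · exact Or.inr (funext fun k => by rw [Subsingleton.elim k 0, h0]; simp)
  rcases hs t with rfl | rfl
  · simp
  · have h1 : hammingNorm (Pi.single 0 1 : BitString 1) = 1 := by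
      simpa using hammingNorm_add_single (t := (0 : BitString 1)) (k := 0) rfl
    have h2 : 0 ≤ α := (norm_nonneg _).trans (h.anticommute 0)
    rcases hs q with rfl | rfl
    · simpa [h1] using h2
    · simpa [h1, bitPow_single, add_comm] using h.anticommute 0

/-- `X ^ q` and `Z ^ t` of one player commute on `ψ` up to the sign `(-1) ^ (q ⬝ t)` and an error
that is linear in the weight of `t`. The factor `3 m - 2` is a common bound for `2 m` when `m ≥ 2`
and for the vanishing contribution of `η` when `m = 1`. -/
theorem norm_bitPow_Z_bitPow_X_sub_le (h : Shadowed X Z R ψ η α) (hη : 0 ≤ η) (hα : 0 ≤ α)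
    (q t : BitString m) :
    ‖bitPow Z t (bitPow X q ψ) - sgn (q ⬝ᵥ t) • bitPow X q (bitPow Z t ψ)‖ ≤
      hammingNorm t * ((3 * m - 2) * η + α) := by
  rcases Nat.lt_trichotomy m 1 with hm | hm | hm
  · obtain rfl : m = 0 := by omega
    rw [Subsingleton.elim t 0, bitPow_zero, dotProduct_zero, hammingNorm_zero]
    simp
  · refine (h.norm_bitPow_Z_bitPow_X_sub_le_of_eq_one hm q t).trans ?_
    subst hm
    gcongr
    push_cast
    linarith
  · refine (h.norm_bitPow_Z_bitPow_X_sub_le_two_mul hη hα q t).trans ?_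
    have : (2 : ℝ) ≤ m := by exact_mod_cast hm
    gcongr
    linarith

end Shadowed
end OneSide

/-! ### Approximate Pauli relations of both players -/

section TwoSides

variable {H : Type*} [NormedAddCommGroup H] [InnerProductSpace ℂ H] {m : ℕ}

/-- What the test says about the observables `X k` and `Z k` of both players: those of one player
satisfy the Pauli relations on `ψ` up to `g` per factor `Z k`, and `X` of one player acts on `ψ`
like `Z` of the other player up to `η`. -/
structure ApproxPauli (X Z : Fin (m + m) → H →L[ℂ] H) (ψ : H) (g η : ℝ) : Prop where
  family_X : ObservableFamily X
  family_Z : ObservableFamily Z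
  commute_XZ : ∀ j k, Commute (X (Fin.castAdd m j)) (Z (Fin.natAdd m k))
  commute_ZX : ∀ j k, Commute (Z (Fin.castAdd m j)) (X (Fin.natAdd m k))
  left : ∀ q t : BitString m,
    ‖bitPow (fun k => Z (Fin.castAdd m k)) t (bitPow (fun k => X (Fin.castAdd m k)) q ψ) -
      sgn (q ⬝ᵥ t) •
        bitPow (fun k => X (Fin.castAdd m k)) q (bitPow (fun k => Z (Fin.castAdd m k)) t ψ)‖ ≤
      hammingNorm t * g
  right : ∀ q t : BitString m,
    ‖bitPow (fun k => Z (Fin.natAdd m k)) t (bitPow (fun k => X (Fin.natAdd m k)) q ψ) -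
      sgn (q ⬝ᵥ t) •
        bitPow (fun k => X (Fin.natAdd m k)) q (bitPow (fun k => Z (Fin.natAdd m k)) t ψ)‖ ≤
      hammingNorm t * g
  swap_left : ∀ k, ‖X (Fin.castAdd m k) ψ - Z (Fin.natAdd m k) ψ‖ ≤ η
  swap_right : ∀ k, ‖X (Fin.natAdd m k) ψ - Z (Fin.castAdd m k) ψ‖ ≤ η

theorem ObservableFamily.comp {n n' : ℕ} {F : Fin n → H →L[ℂ] H} (hF : ObservableFamily F)
    (f : Fin n' → Fin n) : ObservableFamily fun k => F (f k) :=
  ⟨fun _ => hF.observable _, fun _ _ => hF.commute _ _⟩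

theorem commute_bitPow_bitPow {n n' : ℕ} {F : Fin n → H →L[ℂ] H} {G : Fin n' → H →L[ℂ] H}
    (h : ∀ j k, Commute (F j) (G k)) (s : BitString n) (t : BitString n') :
    Commute (bitPow F s) (bitPow G t) :=
  commute_bitPow (fun k => (commute_bitPow (fun j => (h j k).symm) s).symm) t

/-- The bit string with the two halves of `a` exchanged. -/
def swapHalves (a : BitString (m + m)) : BitString (m + m) := Fin.append a.right a.left

@[simp] theorem swapHalves_left (a : BitString (m + m)) : (swapHalves a).left = a.right := by
  ext k; simp [swapHalves]

@[simp] theorem swapHalves_right (a : BitString (m + m)) : (swapHalves a).right = a.left := by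
  ext k; simp only [swapHalves, BitString.right, Fin.append_right]

namespace ApproxPauli

variable {X Z : Fin (m + m) → H →L[ℂ] H} {ψ : H} {g η : ℝ}

theorem norm_bitPow_Z_bitPow_X_sub_le (h : ApproxPauli X Z ψ g η) (q t : BitString (m + m)) :
    ‖bitPow Z t (bitPow X q ψ) - sgn (q ⬝ᵥ t) • bitPow X q (bitPow Z t ψ)‖ ≤
      hammingNorm t * g := by
  simp only [bitPow_left_mul_right X, bitPow_left_mul_right Z, mul_apply_eq_comp,
    dotProduct_left_add_right q t, sgn_add]
  have hl := h.left q.left t.left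
  have hr := h.right q.right t.right
  have hZA := h.family_Z.comp (Fin.castAdd m)
  have hXB := h.family_X.comp (Fin.natAdd m)
  have hZB := h.family_Z.comp (Fin.natAdd m)
  have hXA := h.family_X.comp (Fin.castAdd m)
  have cZX := (commute_bitPow_bitPow h.commute_ZX t.left q.right).apply_comm
  have cXZ := (commute_bitPow_bitPow h.commute_XZ q.left t.right).apply_comm
  have cXX := (commute_bitPow_bitPow (fun j k => h.family_X.commute (Fin.castAdd m j)
    (Fin.natAdd m k)) q.left q.right).apply_comm
  have cZZ := (commute_bitPow_bitPow (fun j k => h.family_Z.commute (Fin.castAdd m j)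
    (Fin.natAdd m k)) t.left t.right).apply_comm
  set XA := bitPow (fun k => X (Fin.castAdd m k)) q.left
  set ZA := bitPow (fun k => Z (Fin.castAdd m k)) t.left
  set XB := bitPow (fun k => X (Fin.natAdd m k)) q.right
  set ZB := bitPow (fun k => Z (Fin.natAdd m k)) t.right
  have e1 : ZA (ZB (XA (XB ψ))) = ZA (XA (ZB (XB ψ))) := by rw [cXZ]
  have e2 : XA (XB (ZA (ZB ψ))) = XA (ZA (XB (ZB ψ))) := by rw [cZX]
  have e3 : ZA (XA (XB (ZB ψ))) = XB (ZB (ZA (XA ψ))) := by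
    rw [cXX, cXZ, cZX, cZZ]
  have e4 : XA (ZA (XB (ZB ψ))) = XB (ZB (XA (ZA ψ))) := by
    rw [cZX, cZZ, cXX, cXZ]
  have h1 := norm_sub_le_norm_sub_add_norm_sub (ZA (XA (ZB (XB ψ))))
    (ZA (XA (sgn (q.right ⬝ᵥ t.right) • XB (ZB ψ))))
    ((sgn (q.left ⬝ᵥ t.left) * sgn (q.right ⬝ᵥ t.right)) • XA (ZA (XB (ZB ψ))))
  rw [hZA.norm_bitPow_sub_apply, hXA.norm_bitPow_sub_apply] at h1
  have e5 : ‖ZA (XA (sgn (q.right ⬝ᵥ t.right) • XB (ZB ψ))) -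
      (sgn (q.left ⬝ᵥ t.left) * sgn (q.right ⬝ᵥ t.right)) • XA (ZA (XB (ZB ψ)))‖ =
      ‖ZA (XA ψ) - sgn (q.left ⬝ᵥ t.left) • XA (ZA ψ)‖ := by
    rw [map_smul, map_smul, e3, e4, mul_comm, mul_smul, ← smul_sub, norm_smul, norm_sgn, one_mul,
      ← map_smul, ← map_smul, hXB.norm_bitPow_sub_apply, hZB.norm_bitPow_sub_apply]
  rw [e1, e2, ← hammingNorm_left_add_right t]
  push_cast
  linarith

/-- The stabilizers of the ideal state almost stabilize `ψ`, also after conjugation by `Z ^ t`. -/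
theorem norm_stabilizer_sub_le (h : ApproxPauli X Z ψ g η) (hg : 0 ≤ g) (hη : 0 ≤ η)
    (a t : BitString (m + m)) :
    ‖bitPow Z t ψ - (sgn (a.left ⬝ᵥ a.right) * sgn (a ⬝ᵥ t)) •
      bitPow X a (bitPow Z (t + swapHalves a) ψ)‖ ≤ 2 * m * (g + η) := by
  have hw (s : BitString m) : (hammingNorm s : ℝ) ≤ m := by exact_mod_cast hammingNorm_le s
  have hZA := h.family_Z.comp (Fin.castAdd m)
  have hXB := h.family_X.comp (Fin.natAdd m)
  have hZB := h.family_Z.comp (Fin.natAdd m)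
  have hXA := h.family_X.comp (Fin.castAdd m)
  have hl := (h.left a.left t.left).trans (mul_le_mul_of_nonneg_right (hw _) hg)
  have hr := (h.right a.right (t.right + a.left)).trans (mul_le_mul_of_nonneg_right (hw _) hg)
  have hsl : ‖bitPow (fun k => X (Fin.castAdd m k)) a.left ψ -
      bitPow (fun k => Z (Fin.natAdd m k)) a.left ψ‖ ≤ m * η :=
    (hXA.norm_bitPow_sub_bitPow_le hZB h.commute_XZ _ fun j _ => h.swap_left j).trans
      (mul_le_mul_of_nonneg_right (hw _) hη)
  have hsr : ‖bitPow (fun k => X (Fin.natAdd m k)) a.right ψ -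
      bitPow (fun k => Z (Fin.castAdd m k)) a.right ψ‖ ≤ m * η :=
    (hXB.norm_bitPow_sub_bitPow_le hZA (fun j k => (h.commute_ZX k j).symm) _
      fun j _ => h.swap_right j).trans (mul_le_mul_of_nonneg_right (hw _) hη)
  have hL : (t + swapHalves a).left = t.left + a.right := by rw [← swapHalves_left a]; rfl
  have hR : (t + swapHalves a).right = t.right + a.left := by rw [← swapHalves_right a]; rfl
  simp only [bitPow_left_mul_right X, bitPow_left_mul_right Z, mul_apply_eq_comp,
    dotProduct_left_add_right a t, sgn_add, hL, hR]
  rw [dotProduct_add, dotProduct_comm a.right a.left, sgn_add] at hr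
  have cXZ (s t : BitString m) := (commute_bitPow_bitPow h.commute_XZ s t).apply_comm
  have cZX (s t : BitString m) := (commute_bitPow_bitPow h.commute_ZX s t).apply_comm
  have cZZ (s t : BitString m) := (commute_bitPow_bitPow (fun j k =>
    h.family_Z.commute (Fin.castAdd m j) (Fin.natAdd m k)) s t).apply_comm
  have aZA := hZA.bitPow_add_apply
  have aZB := hZB.bitPow_add_apply
  have iZA := hZA.bitPow_bitPow_apply
  have iZB := hZB.bitPow_bitPow_apply
  have nXA := hXA.norm_bitPow_sub_apply
  have nZA := hZA.norm_bitPow_sub_apply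
  have nZB := hZB.norm_bitPow_sub_apply
  set XA := bitPow (fun k => X (Fin.castAdd m k))
  set ZA := bitPow (fun k => Z (Fin.castAdd m k))
  set XB := bitPow (fun k => X (Fin.natAdd m k))
  set ZB := bitPow (fun k => Z (Fin.natAdd m k))
  set σ := sgn (a.left ⬝ᵥ t.left)
  set τ := sgn (a.right ⬝ᵥ t.right) * sgn (a.left ⬝ᵥ a.right)
  have hσ : ‖σ‖ = 1 := norm_sgn _
  -- Bob's factors are exchanged
  have h1 : ‖(σ * τ) • XA a.left (ZA (t.left + a.right) (XB a.right (ZB (t.right + a.left) ψ))) -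
      σ • XA a.left (ZA (t.left + a.right) (ZB (t.right + a.left) (XB a.right ψ)))‖ ≤ m * g := by
    rw [mul_smul, ← smul_sub, norm_smul, hσ, one_mul, ← map_smul, ← map_smul, nXA, nZA,
      norm_sub_rev]
    exact hr
  -- Bob's `X` becomes Alice's `Z`
  have h2 : ‖σ • XA a.left (ZA (t.left + a.right) (ZB (t.right + a.left) (XB a.right ψ))) -
      σ • ZB (t.right + a.left) (XA a.left (ZA t.left ψ))‖ ≤ m * η := by
    have e : ZB (t.right + a.left) (XA a.left (ZA t.left ψ)) =
        XA a.left (ZA (t.left + a.right) (ZB (t.right + a.left) (ZA a.right ψ))) := by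
      rw [← cZZ, ← aZA, add_assoc, add_self, add_zero, ← cXZ, ← cZZ]
    rw [← smul_sub, norm_smul, hσ, one_mul, e, nXA, nZA, nZB]
    exact hsr
  -- Alice's factors are exchanged
  have h3 : ‖σ • ZB (t.right + a.left) (XA a.left (ZA t.left ψ)) -
      ZB (t.right + a.left) (ZA t.left (XA a.left ψ))‖ ≤ m * g := by
    rw [← map_smul, nZB, norm_sub_rev]
    exact hl
  -- Alice's `X` becomes Bob's `Z`
  have h4 : ‖ZB (t.right + a.left) (ZA t.left (XA a.left ψ)) -
      ZA t.left (ZB t.right ψ)‖ ≤ m * η := by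
    have e : ZA t.left (ZB t.right ψ) = ZB (t.right + a.left) (ZA t.left (ZB a.left ψ)) := by
      rw [← cZZ, ← aZB, add_assoc, add_self, add_zero]
    rw [e, nZB, nZA]
    exact hsl
  rw [show sgn (a.left ⬝ᵥ a.right) * (sgn (a.left ⬝ᵥ t.left) * sgn (a.right ⬝ᵥ t.right)) = σ * τ by
    simp only [σ, τ]; ring, norm_sub_rev, ← cZX]
  refine (norm_sub_le_norm_sub_add_norm_sub _ _ _).trans (le_trans (add_le_add h1
    ((norm_sub_le_norm_sub_add_norm_sub _ _ _).trans (add_le_add h2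
    ((norm_sub_le_norm_sub_add_norm_sub _ _ _).trans (add_le_add h3 h4))))) ?_)
  linarith

end ApproxPauli

end TwoSides

/-! ### The extraction isometry -/

section Extraction

variable {H : Type*} [NormedAddCommGroup H] [InnerProductSpace ℂ H] {n : ℕ}

/-- The vector `∑ u, f u ⊗ |u⟩`. -/
noncomputable def tensorSum (f : BitString n → H) : H ⊗[ℂ] Qubits n :=
  ∑ u, f u ⊗ₜ[ℂ] EuclideanSpace.single u (1 : ℂ)

theorem norm_sq_tensorSum (f : BitString n → H) : ‖tensorSum f‖ ^ 2 = ∑ u, ‖f u‖ ^ 2 := by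
  rw [← re_inner_self, tensorSum, sum_inner]
  simp only [inner_sum, TensorProduct.inner_tmul, EuclideanSpace.inner_single_left,
    PiLp.single_apply, map_one, one_mul]
  simp only [mul_ite, mul_one, mul_zero, Finset.sum_ite_eq, Finset.mem_univ, if_true,
    Complex.re_sum, re_inner_self]

theorem tensorSum_sub (f g : BitString n → H) :
    tensorSum (fun u => f u - g u) = tensorSum f - tensorSum g := by
  simp only [tensorSum, TensorProduct.sub_tmul, Finset.sum_sub_distrib]

theorem tensorSum_smul_eq_tmul (v : Qubits n) (x : H) : tensorSum (fun u => v u • x) = x ⊗ₜ v := by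
  simp only [tensorSum, TensorProduct.smul_tmul, ← TensorProduct.tmul_sum]
  congr 1
  ext u
  simp [WithLp.ofLp_sum, Finset.sum_apply, Pi.single_apply]

/-- The component at `|u⟩` of the extracted state: the circuit that swaps the state of the untrusted
qubits, on which `X` and `Z` act, into `n` fresh qubits maps `φ` to
`∑ u, X ^ u P_u φ ⊗ |u⟩`, where `P_u φ`, a Fourier coefficient of `t ↦ Z ^ t φ`, is the joint
eigenprojection of the `Z k` for the eigenvalues `(-1) ^ u_k`. -/
noncomputable def extract (X Z : Fin n → H →L[ℂ] H) (φ : H) (u : BitString n) : H :=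
  bitPow X u (fourier (fun t => bitPow Z t φ) u)

variable {X Z : Fin n → H →L[ℂ] H}

theorem sum_norm_sq_extract (hX : ObservableFamily X) (hZ : ObservableFamily Z) (φ : H) :
    ∑ u, ‖extract X Z φ u‖ ^ 2 = ‖φ‖ ^ 2 := by
  simp only [extract, hX.norm_bitPow_apply, sum_norm_sq_fourier, hZ.norm_bitPow_apply]
  simp

/-- The distance between the extraction of `φ` and `X ^ q Z ^ p`, applied to the extraction of `ψ`,
is an average over the group generated by the `Z k`. -/
theorem sum_norm_sq_extract_sub (hX : ObservableFamily X) (φ ψ : H)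
    (q p : BitString n) (c : ℂ) :
    ∑ u, ‖extract X Z φ u - (c * sgn (p ⬝ᵥ (u + q))) • extract X Z ψ (u + q)‖ ^ 2 =
      ((2 : ℝ) ^ n)⁻¹ * ∑ t, ‖bitPow Z t φ -
        (c * sgn (q ⬝ᵥ t)) • bitPow X q (bitPow Z (t + p) ψ)‖ ^ 2 := by
  rw [← sum_norm_sq_fourier]
  refine Finset.sum_congr rfl fun u _ => ?_
  have e1 : fourier (fun t => bitPow Z t φ -
      (c * sgn (q ⬝ᵥ t)) • bitPow X q (bitPow Z (t + p) ψ)) u =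
      fourier (fun t => bitPow Z t φ) u -
        (c * sgn (p ⬝ᵥ (u + q))) • bitPow X q (fourier (fun t => bitPow Z t ψ) (u + q)) := by
    simp only [fourier, smul_sub, Finset.sum_sub_distrib, map_smul, map_sum]
    congr 1
    rw [smul_comm]
    congr 1
    rw [Finset.smul_sum]
    refine Fintype.sum_equiv (Equiv.addRight p) _ _ fun t => ?_
    simp only [Equiv.coe_addRight, smul_smul]
    congr 1
    have := sgn_mul_self (p ⬝ᵥ (u + q))
    rw [dotProduct_add (u + q), sgn_add, dotProduct_comm (u + q) p, add_dotProduct u q t, sgn_add]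
    linear_combination (-(c * sgn (u ⬝ᵥ t) * sgn (q ⬝ᵥ t))) * this
  rw [e1, extract, extract, hX.bitPow_add_apply, ← map_smul, hX.norm_bitPow_sub_apply]

/-- The isometry `φ ↦ ∑ u, X ^ u P_u φ ⊗ |u⟩`. -/
noncomputable def extraction (hX : ObservableFamily X) (hZ : ObservableFamily Z) :
    H →ₗᵢ[ℂ] H ⊗[ℂ] Qubits n where
  toFun φ := tensorSum (extract X Z φ)
  map_add' φ φ' := by
    simp only [tensorSum, extract, fourier, map_add, smul_add, Finset.sum_add_distrib,
      TensorProduct.add_tmul]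
  map_smul' c φ := by
    simp only [tensorSum, extract, fourier, map_smul, Finset.smul_sum, map_sum,
      TensorProduct.smul_tmul', smul_comm c, RingHom.id_apply]
  norm_map' φ := by
    rw [← sq_eq_sq₀ (norm_nonneg _) (norm_nonneg _), ← sum_norm_sq_extract hX hZ,
      ← norm_sq_tensorSum]
    rfl

end Extraction

/-! ### The junk state -/

section Junk

variable {H : Type*} [NormedAddCommGroup H] [InnerProductSpace ℂ H] {m : ℕ}

theorem conj_idealState (u : BitString (m + m)) :
    (starRingEnd ℂ) (idealState m u) = idealState m u := by
  simp only [idealState_apply, map_mul, map_inv₀, map_pow, map_ofNat, conj_sgn]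

theorem norm_sq_idealState_apply (u : BitString (m + m)) :
    ‖idealState m u‖ ^ 2 = ((2 : ℝ) ^ (m + m))⁻¹ := by
  rw [idealState_apply]
  simp [pow_add, pow_two]

theorem norm_pauli_idealState (p q : BitString (m + m)) :
    ‖(bitPow pauliX q * bitPow pauliZ p) (idealState m)‖ = 1 := by
  rw [← sq_eq_sq₀ (norm_nonneg _) zero_le_one, EuclideanSpace.norm_sq_eq]
  simp only [Module.End.mul_apply, bitPow_pauliX_apply, bitPow_pauliZ_apply, norm_mul, norm_sgn,
    one_mul, norm_sq_idealState_apply]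
  simp

/-- The ideal state is stabilized by the operators `± X ^ a Z ^ ã`, where `ã` is `a` with its halves
exchanged. -/
theorem idealState_mul_idealState_add (a u : BitString (m + m)) :
    idealState m u * idealState m (u + a) = ((2 : ℂ) ^ (m + m))⁻¹ *
      (sgn (a.left ⬝ᵥ a.right) * sgn (swapHalves a ⬝ᵥ (u + a))) := by
  rw [idealState_apply, idealState_apply]
  have hl : (u + a).left = u.left + a.left := rfl
  have hr : (u + a).right = u.right + a.right := rfl
  simp only [dotProduct_left_add_right (swapHalves a), swapHalves_left, swapHalves_right, hl, hr,
    dotProduct_add, add_dotProduct, sgn_add, dotProduct_comm a.right a.left,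
    dotProduct_comm a.right u.left, pow_add, mul_inv]
  have h1 := sgn_mul_self (u.left ⬝ᵥ u.right)
  have h2 := sgn_mul_self (a.left ⬝ᵥ a.right)
  linear_combination ((2 : ℂ) ^ m)⁻¹ * ((2 : ℂ) ^ m)⁻¹ * sgn (u.left ⬝ᵥ a.right) *
    sgn (a.left ⬝ᵥ u.right) * sgn (a.left ⬝ᵥ a.right) * (h1 - h2)

/-- The squared distance of a unit vector `∑ u, v u ⊗ |u⟩` from `x ⊗ idealState`. -/
theorem sum_norm_sq_sub_idealState {v : BitString (m + m) → H} (hv : ∑ u, ‖v u‖ ^ 2 = 1) {x : H}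
    (hx : ‖x‖ = 1) : ∑ u, ‖v u - idealState m u • x‖ ^ 2 =
      2 - 2 * (inner ℂ (∑ u, idealState m u • v u) x).re := by
  have h1 (u : BitString (m + m)) : ‖v u - idealState m u • x‖ ^ 2 =
      ‖v u‖ ^ 2 - 2 * (inner ℂ (idealState m u • v u) x).re + ((2 : ℝ) ^ (m + m))⁻¹ := by
    rw [norm_sub_sq (𝕜 := ℂ), norm_smul, mul_pow, norm_sq_idealState_apply, hx, inner_smul_left,
      conj_idealState, inner_smul_right]
    simp
  simp only [h1, Finset.sum_add_distrib, Finset.sum_sub_distrib, hv, ← Finset.mul_sum,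
    sum_inner, Complex.re_sum, Finset.sum_const, Finset.card_univ, nsmul_eq_mul]
  have h2 : ((Fintype.card (BitString (m + m)) : ℕ) : ℝ) = 2 ^ (m + m) := by simp
  rw [h2, mul_inv_cancel₀ (by positivity)]
  ring

/-- A unit vector `∑ u, v u ⊗ |u⟩` that is almost stabilized by the stabilizer group of the ideal
state is close to a product with it: the projection on the multiples of the ideal state is the
average of the stabilizer group. -/
theorem exists_junk [Nontrivial H] {v : BitString (m + m) → H} (hv : ∑ u, ‖v u‖ ^ 2 = 1) {K : ℝ}
    (hK : ∀ a, ∑ u, ‖v u - (sgn (a.left ⬝ᵥ a.right) * sgn (swapHalves a ⬝ᵥ (u + a))) •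
      v (u + a)‖ ^ 2 ≤ K) :
    ∃ x : H, ‖x‖ = 1 ∧ ∑ u, ‖v u - idealState m u • x‖ ^ 2 ≤ K := by
  set y := ∑ u, idealState m u • v u with hy
  have hy1 : 1 - K / 2 ≤ ‖y‖ ^ 2 := by
    have e1 : ‖y‖ ^ 2 = ∑ a : BitString (m + m), ((2 : ℝ) ^ (m + m))⁻¹ * ∑ u,
        (inner ℂ (v u) ((sgn (a.left ⬝ᵥ a.right) * sgn (swapHalves a ⬝ᵥ (u + a))) •
          v (u + a))).re := by
      have e2 : inner ℂ y y = ∑ u, ∑ a : BitString (m + m),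
          (((2 : ℝ) ^ (m + m))⁻¹ : ℝ) * inner ℂ (v u) ((sgn (a.left ⬝ᵥ a.right) *
            sgn (swapHalves a ⬝ᵥ (u + a))) • v (u + a)) := by
        rw [hy, sum_inner]
        refine Finset.sum_congr rfl fun u _ => ?_
        rw [inner_sum]
        refine (Fintype.sum_equiv (Equiv.addLeft u) _ _ fun a => ?_).symm
        rw [Equiv.coe_addLeft, inner_smul_left, inner_smul_right, inner_smul_right,
          conj_idealState, ← mul_assoc (idealState m u), idealState_mul_idealState_add]
        push_cast
        ring
      rw [← re_inner_self, e2, Finset.sum_comm, Complex.re_sum]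
      refine Finset.sum_congr rfl fun a _ => ?_
      rw [← Finset.mul_sum, Complex.re_ofReal_mul, Complex.re_sum]
    have e3 (a : BitString (m + m)) : 1 - K / 2 ≤ ∑ u,
        (inner ℂ (v u) ((sgn (a.left ⬝ᵥ a.right) * sgn (swapHalves a ⬝ᵥ (u + a))) •
          v (u + a))).re := by
      have h1 := hK a
      simp only [norm_sub_sq (𝕜 := ℂ), norm_smul, norm_mul, norm_sgn, one_mul,
        Finset.sum_add_distrib, Finset.sum_sub_distrib, ← Finset.mul_sum, hv] at h1
      have h2 : ∑ u, ‖v (u + a)‖ ^ 2 = 1 := by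
        rw [← hv]
        exact Fintype.sum_equiv (Equiv.addRight a) _ _ fun u => rfl
      rw [h2] at h1
      simp only [RCLike.re_eq_complex_re] at h1
      linarith
    rw [e1, ← Finset.mul_sum]
    have h4 := Finset.sum_le_sum fun a (_ : a ∈ (Finset.univ : Finset (BitString (m + m)))) => e3 a
    rw [Finset.sum_const, Finset.card_univ, nsmul_eq_mul] at h4
    have h5 : ((Fintype.card (BitString (m + m)) : ℕ) : ℝ) = 2 ^ (m + m) := by simp
    rw [h5] at h4
    rw [le_inv_mul_iff₀ (by positivity)]
    exact h4
  by_cases h0 : y = 0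
  · obtain ⟨x, hx⟩ := exists_norm_eq H zero_le_one
    refine ⟨x, hx, ?_⟩
    rw [sum_norm_sq_sub_idealState hv hx, ← hy, h0, inner_zero_left]
    simp only [h0, norm_zero] at hy1
    simp only [Complex.zero_re]
    linarith
  · have hpos : 0 < ‖y‖ := norm_pos_iff.2 h0
    have hx : ‖((‖y‖⁻¹ : ℝ) : ℂ) • y‖ = 1 := by
      rw [norm_smul, Complex.norm_real, norm_inv, norm_norm, inv_mul_cancel₀ hpos.ne']
    have h1 := sum_norm_sq_sub_idealState hv hx
    have h2 : (inner ℂ y (((‖y‖⁻¹ : ℝ) : ℂ) • y)).re = ‖y‖ := by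
      rw [inner_smul_right, Complex.re_ofReal_mul, re_inner_self]
      field_simp
    rw [← hy, h2] at h1
    refine ⟨_, hx, ?_⟩
    have h3 : 0 ≤ 2 - 2 * ‖y‖ := h1 ▸ Finset.sum_nonneg fun u _ => sq_nonneg _
    rw [h1]
    nlinarith

end Junk

/-! ### Self-testing from approximate Pauli relations -/

section SelfTest

variable {H : Type*} [NormedAddCommGroup H] [InnerProductSpace ℂ H] {m : ℕ}
  {X Z : Fin (m + m) → H →L[ℂ] H} {ψ : H} {g η : ℝ}

/-- An average of squares is at most the square of a common bound. -/
theorem average_sq_le {n : ℕ} {f : BitString n → ℝ} {K : ℝ} (h0 : ∀ t, 0 ≤ f t)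
    (h : ∀ t, f t ≤ K) : ((2 : ℝ) ^ n)⁻¹ * ∑ t, f t ^ 2 ≤ K ^ 2 := by
  have h1 : ∑ t, f t ^ 2 ≤ ∑ _t : BitString n, K ^ 2 :=
    Finset.sum_le_sum fun t _ => pow_le_pow_left₀ (h0 t) (h t) 2
  rw [Finset.sum_const, Finset.card_univ, nsmul_eq_mul] at h1
  have h2 : ((Fintype.card (BitString n) : ℕ) : ℝ) = 2 ^ n := by simp
  rw [h2] at h1
  rwa [inv_mul_le_iff₀ (by positivity)]

namespace ApproxPauli

/-- The extraction isometry almost intertwines `X ^ q Z ^ p` with the Pauli operators. -/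
theorem sum_norm_sq_extract_sub_le (h : ApproxPauli X Z ψ g η) (hg : 0 ≤ g)
    (p q : BitString (m + m)) :
    ∑ u, ‖extract X Z (bitPow X q (bitPow Z p ψ)) u -
      sgn (p ⬝ᵥ (u + q)) • extract X Z ψ (u + q)‖ ^ 2 ≤
      (hammingNorm p * g + 2 * m * g) ^ 2 := by
  have key := sum_norm_sq_extract_sub (Z := Z) h.family_X (bitPow X q (bitPow Z p ψ)) ψ q p 1
  simp only [one_mul] at key
  rw [key]
  refine average_sq_le (fun _ => norm_nonneg _) fun t => ?_
  have h1 := h.norm_bitPow_Z_bitPow_X_sub_le q p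
  have h2 := h.norm_bitPow_Z_bitPow_X_sub_le q (t + p)
  have h3 : (hammingNorm (t + p) : ℝ) * g ≤ 2 * m * g := by
    have : (hammingNorm (t + p) : ℝ) ≤ ((m + m : ℕ) : ℝ) := by
      exact_mod_cast hammingNorm_le (t + p)
    push_cast at this
    exact mul_le_mul_of_nonneg_right (by linarith) hg
  have e1 : ‖bitPow Z t (bitPow X q (bitPow Z p ψ)) -
      sgn (q ⬝ᵥ p) • bitPow Z (t + p) (bitPow X q ψ)‖ =
      ‖bitPow Z p (bitPow X q ψ) - sgn (q ⬝ᵥ p) • bitPow X q (bitPow Z p ψ)‖ := by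
    rw [h.family_Z.bitPow_add_apply, ← map_smul, h.family_Z.norm_bitPow_sub_apply, norm_sub_rev]
    have : bitPow Z p (bitPow X q ψ) - sgn (q ⬝ᵥ p) • bitPow X q (bitPow Z p ψ) =
        sgn (q ⬝ᵥ p) • (sgn (q ⬝ᵥ p) • bitPow Z p (bitPow X q ψ) - bitPow X q (bitPow Z p ψ)) := by
      rw [smul_sub, smul_smul, sgn_mul_self, one_smul]
    rw [this, norm_smul, norm_sgn, one_mul]
  have e2 : ‖sgn (q ⬝ᵥ p) • bitPow Z (t + p) (bitPow X q ψ) -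
      sgn (q ⬝ᵥ t) • bitPow X q (bitPow Z (t + p) ψ)‖ =
      ‖bitPow Z (t + p) (bitPow X q ψ) -
        sgn (q ⬝ᵥ (t + p)) • bitPow X q (bitPow Z (t + p) ψ)‖ := by
    have : sgn (q ⬝ᵥ t) = sgn (q ⬝ᵥ p) * sgn (q ⬝ᵥ (t + p)) := by
      rw [dotProduct_add, sgn_add, mul_left_comm, sgn_mul_self, mul_one]
    rw [this, mul_smul, ← smul_sub, norm_smul, norm_sgn, one_mul]
  refine (norm_sub_le_norm_sub_add_norm_sub _
    (sgn (q ⬝ᵥ p) • bitPow Z (t + p) (bitPow X q ψ)) _).trans ?_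
  rw [e1, e2]
  linarith

theorem exists_junk (h : ApproxPauli X Z ψ g η) (hψ : ‖ψ‖ = 1) (hg : 0 ≤ g) (hη : 0 ≤ η) :
    ∃ x : H, ‖x‖ = 1 ∧ ∑ u, ‖extract X Z ψ u - idealState m u • x‖ ^ 2 ≤
      (2 * m * (g + η)) ^ 2 := by
  have : Nontrivial H := ⟨ψ, 0, by rintro rfl; simp at hψ⟩
  refine ParallelSelfTest.exists_junk ?_ fun a => ?_
  · rw [sum_norm_sq_extract h.family_X h.family_Z, hψ, one_pow]
  · rw [sum_norm_sq_extract_sub h.family_X]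
    exact average_sq_le (fun _ => norm_nonneg _) (h.norm_stabilizer_sub_le hg hη a)

/-- The distance of the extracted states from the ideal ones, tensored with a common junk state. -/
theorem exists_junk_norm_extraction_sub_le (h : ApproxPauli X Z ψ g η) (hψ : ‖ψ‖ = 1) (hg : 0 ≤ g)
    (hη : 0 ≤ η) :
    ∃ x : H, ‖x‖ = 1 ∧ ∀ p q : BitString (m + m),
      ‖extraction h.family_X h.family_Z ((bitPow X q * bitPow Z p) ψ) -
        x ⊗ₜ[ℂ] ((bitPow pauliX q * bitPow pauliZ p) (idealState m))‖ ≤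
      hammingNorm p * g + 2 * m * g + 2 * m * (g + η) := by
  obtain ⟨x, hx, hx'⟩ := h.exists_junk hψ hg hη
  refine ⟨x, hx, fun p q => ?_⟩
  have e1 : extraction h.family_X h.family_Z ((bitPow X q * bitPow Z p) ψ) =
      tensorSum (extract X Z (bitPow X q (bitPow Z p ψ))) := rfl
  have e2 (u : BitString (m + m)) : (bitPow pauliX q * bitPow pauliZ p) (idealState m) u =
      sgn (p ⬝ᵥ (u + q)) * idealState m (u + q) := by
    rw [Module.End.mul_apply, bitPow_pauliX_apply, bitPow_pauliZ_apply]
  rw [e1, ← tensorSum_smul_eq_tmul]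
  refine (norm_sub_le_norm_sub_add_norm_sub _
    (tensorSum fun u => sgn (p ⬝ᵥ (u + q)) • extract X Z ψ (u + q)) _).trans ?_
  rw [← tensorSum_sub, ← tensorSum_sub]
  refine add_le_add ?_ ?_
  · refine le_of_sq_le_sq ?_ (by positivity)
    rw [norm_sq_tensorSum]
    exact h.sum_norm_sq_extract_sub_le hg p q
  · refine le_of_sq_le_sq ?_ (by positivity)
    rw [norm_sq_tensorSum]
    refine le_trans (le_of_eq ?_) hx'
    refine Fintype.sum_equiv (Equiv.addRight q) _ _ fun u => ?_
    rw [e2, mul_smul, ← smul_sub, norm_smul, norm_sgn, one_mul]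
    rfl

end ApproxPauli

end SelfTest

/-! ### The error bound -/

theorem two_rpow_quarter_le : (2 : ℝ) ^ (1 / 4 : ℝ) ≤ 1.19 := by
  have h : ((2 : ℝ) ^ (1 / 4 : ℝ)) ^ 4 = 2 := by
    rw [← Real.rpow_natCast, ← Real.rpow_mul (by norm_num)]
    norm_num
  refine le_of_pow_le_pow_left₀ (n := 4) (by norm_num) (by norm_num) ?_
  rw [h]
  norm_num

theorem one_le_two_rpow_quarter : 1 ≤ (2 : ℝ) ^ (1 / 4 : ℝ) :=
  Real.one_le_rpow (by norm_num) (by norm_num)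

/-- The distance `D` of two unit vectors is at most `2`, so that a bound linear in `√(2 ε)` implies
one by `√√(2 ε)`, with a constant that is the square root of twice the original one. -/
theorem le_errorBound {n w : ℕ} (hw : w ≤ n) {D ε : ℝ} (hD0 : 0 ≤ D) (hD : D ≤ 2)
    (h : D ≤ ((3 * n / 2 - 2 + 2 * (2 : ℝ) ^ (1 / 4 : ℝ)) * (w + 2 * n) + n) * √(2 * ε)) :
    D ≤ errorBound n w ε := by
  have hβ := two_rpow_quarter_le
  have hβ1 := one_le_two_rpow_quarter
  have e1 : (2 : ℝ) ^ (5 / 4 : ℝ) = 2 * (2 : ℝ) ^ (1 / 4 : ℝ) := by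
    rw [show (5 / 4 : ℝ) = 1 + 1 / 4 by norm_num, Real.rpow_add (by norm_num), Real.rpow_one]
  have e2 : 1 / (2 : ℝ) ^ (3 / 4 : ℝ) = (2 : ℝ) ^ (1 / 4 : ℝ) / 2 := by
    rw [show (3 / 4 : ℝ) = 1 - 1 / 4 by norm_num, Real.rpow_sub (by norm_num), Real.rpow_one,
      one_div_div]
  rw [errorBound, e1, e2, Real.sqrt_mul (Real.sqrt_nonneg _), Real.sqrt_mul (Real.sqrt_nonneg _),
    ← mul_add]
  set β := (2 : ℝ) ^ (1 / 4 : ℝ)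
  have hw' : (w : ℝ) ≤ n := by exact_mod_cast hw
  have hw0 : (0 : ℝ) ≤ w := by positivity
  have hn2 : (n : ℝ) ≤ n * n := by exact_mod_cast Nat.le_mul_self n
  have hnw : (w : ℝ) ≤ n * w := by
    rcases Nat.eq_zero_or_pos n with rfl | hn
    · simp [show w = 0 by omega]
    · exact_mod_cast Nat.le_mul_of_pos_left w hn
  generalize (n : ℝ) = N at *
  generalize (w : ℝ) = W at *
  have hN : 0 ≤ N := hw0.trans hw'
  have hww : W * W ≤ N * W := mul_le_mul_of_nonneg_right hw' hw0
  have hNβ : N ≤ N * β := le_mul_of_one_le_right hN hβ1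
  have hWβ : W ≤ W * β := le_mul_of_one_le_right hw0 hβ1
  have hNβ' : N * β ≤ N * 1.19 := mul_le_mul_of_nonneg_left hβ hN
  have hWβ' : W * β ≤ W * 1.19 := mul_le_mul_of_nonneg_left hβ hw0
  -- linear lower bounds for both square roots, chosen so that their product suffices in `hK`
  have hC1 : (3 / 2 * N) ^ 2 ≤ 9 * N ^ 2 / 4 + (3 + 2 * β) * N / 2 := by nlinarith
  have hC2 : (1.06 * N + 0.84 * W) ^ 2 ≤
      9 * N ^ 2 / 8 + N * (5 * W / 2 - 1 / 4 + β / 2) + W * (β - 1 / 2) := by nlinarith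
  have hx := Real.le_sqrt_of_sq_le hC1
  have hy := Real.le_sqrt_of_sq_le hC2
  have hx2 := Real.sq_sqrt ((sq_nonneg _).trans hC1)
  have hy2 := Real.sq_sqrt ((sq_nonneg _).trans hC2)
  set x := √(9 * N ^ 2 / 4 + (3 + 2 * β) * N / 2)
  set y := √(9 * N ^ 2 / 8 + N * (5 * W / 2 - 1 / 4 + β / 2) + W * (β - 1 / 2))
  have hxy : 3 / 2 * N * (1.06 * N + 0.84 * W) ≤ x * y :=
    mul_le_mul hx hy (by positivity) (Real.sqrt_nonneg _)
  have hK : 2 * ((3 * N / 2 - 2 + 2 * β) * (W + 2 * N) + N) ≤ (x + y) ^ 2 := by nlinarith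
  refine le_of_sq_le_sq ?_ (by positivity)
  rw [mul_pow, Real.sq_sqrt (Real.sqrt_nonneg _)]
  have h1 : D ^ 2 ≤ 2 * D := by nlinarith
  have h2 := mul_le_mul_of_nonneg_left hK (Real.sqrt_nonneg (2 * ε))
  linarith

/-! ### The observables of the players -/

section Players

variable {HA : Type u} {HB : Type v}
  [NormedAddCommGroup HA] [InnerProductSpace ℂ HA]
  [NormedAddCommGroup HB] [InnerProductSpace ℂ HB]

open UniformSpace in
theorem completion_mapL_mul (S S' : HA →L[ℂ] HA) (T T' : HB →L[ℂ] HB) :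
    (TensorProduct.mapL S T).completion * (TensorProduct.mapL S' T').completion =
      (TensorProduct.mapL (S * S') (T * T')).completion := by
  ext x
  induction x using Completion.induction_on with
  | hp => exact isClosed_eq (ContinuousLinearMap.continuous _) (ContinuousLinearMap.continuous _)
  | ih x =>
    rw [mul_apply_eq_comp, ContinuousLinearMap.completion_apply_coe,
      ContinuousLinearMap.completion_apply_coe, ContinuousLinearMap.completion_apply_coe,
      TensorProduct.mapL_mul]
    rfl

open UniformSpace in
theorem completion_mapL_one :
    (TensorProduct.mapL (1 : HA →L[ℂ] HA) (1 : HB →L[ℂ] HB)).completion = 1 := by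
  ext x
  induction x using Completion.induction_on with
  | hp => exact isClosed_eq (ContinuousLinearMap.continuous _) (ContinuousLinearMap.continuous _)
  | ih x =>
    rw [ContinuousLinearMap.completion_apply_coe]
    congr 1
    exact congrArg (fun f => f x) TensorProduct.mapL_id_id

open UniformSpace in
theorem inner_completion_mapL {S : HA →L[ℂ] HA} {T : HB →L[ℂ] HB}
    (hS : ∀ x y, inner ℂ (S x) y = inner ℂ x (S y)) (hT : ∀ x y, inner ℂ (T x) y = inner ℂ x (T y))
    (x y : HilbertTensor HA HB) :
    inner ℂ ((TensorProduct.mapL S T).completion x) y =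
      inner ℂ x ((TensorProduct.mapL S T).completion y) := by
  induction x, y using Completion.induction_on₂ with
  | hp =>
    exact isClosed_eq (((ContinuousLinearMap.continuous _).comp continuous_fst).inner continuous_snd)
      (continuous_fst.inner ((ContinuousLinearMap.continuous _).comp continuous_snd))
  | ih x y =>
    rw [ContinuousLinearMap.completion_apply_coe, ContinuousLinearMap.completion_apply_coe,
      Completion.inner_coe, Completion.inner_coe]
    induction x with
    | zero => simp
    | add x x' hx hx' => rw [map_add, inner_add_left, hx, hx', inner_add_left]
    | tmul a b =>
      induction y with
      | zero => simp
      | add y y' hy hy' => rw [map_add, inner_add_right, hy, hy', inner_add_right]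
      | tmul a' b' => simp [hS, hT]

theorem isObservable_onAlice {T : HA →L[ℂ] HA} (hT : IsObservable T) :
    IsObservable (onAlice T : HilbertTensor HA HB →L[ℂ] HilbertTensor HA HB) where
  symm := inner_completion_mapL hT.symm fun _ _ => rfl
  mul_self := by
    rw [onAlice, completion_mapL_mul, hT.mul_self]
    exact completion_mapL_one

theorem isObservable_onBob {T : HB →L[ℂ] HB} (hT : IsObservable T) :
    IsObservable (onBob T : HilbertTensor HA HB →L[ℂ] HilbertTensor HA HB) where
  symm := inner_completion_mapL (fun _ _ => rfl) hT.symm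
  mul_self := by
    rw [onBob, completion_mapL_mul, hT.mul_self]
    exact completion_mapL_one

theorem commute_onAlice_onAlice {S T : HA →L[ℂ] HA} (h : Commute S T) :
    Commute (onAlice S : HilbertTensor HA HB →L[ℂ] _) (onAlice T) := by
  rw [commute_iff_eq, onAlice, onAlice, completion_mapL_mul, completion_mapL_mul, h.eq]

theorem commute_onBob_onBob {S T : HB →L[ℂ] HB} (h : Commute S T) :
    Commute (onBob S : HilbertTensor HA HB →L[ℂ] _) (onBob T) := by
  rw [commute_iff_eq, onBob, onBob, completion_mapL_mul, completion_mapL_mul, h.eq]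

theorem commute_onAlice_onBob (S : HA →L[ℂ] HA) (T : HB →L[ℂ] HB) :
    Commute (onAlice S : HilbertTensor HA HB →L[ℂ] _) (onBob T) := by
  rw [commute_iff_eq, onAlice, onBob, completion_mapL_mul, completion_mapL_mul]
  rfl

end Players

namespace ProjMeasurement

variable {H : Type*} [NormedAddCommGroup H] [InnerProductSpace ℂ H] [CompleteSpace H] {m : ℕ}
  (P : ProjMeasurement (Answer m) H)

theorem observable_eq_sum (k : Fin m) :
    P.observable k = ∑ a : Answer m, (((a k : ℤˣ) : ℤ) : ℂ) • P.proj a := by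
  rw [observable, symbolProj, symbolProj, Finset.sum_filter, Finset.sum_filter,
    ← Finset.sum_sub_distrib]
  refine Finset.sum_congr rfl fun a _ => ?_
  rcases Int.units_eq_one_or (a k) with h | h <;> simp [h, show (1 : ℤˣ) ≠ -1 by decide]

theorem observable_mul_observable (j k : Fin m) :
    P.observable j * P.observable k =
      ∑ a : Answer m, ((((a j * a k : ℤˣ)) : ℤ) : ℂ) • P.proj a := by
  rw [observable_eq_sum, observable_eq_sum, Finset.sum_mul_sum]
  refine Finset.sum_congr rfl fun a _ => ?_
  rw [Finset.sum_eq_single a]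
  · rw [smul_mul_smul_comm, (P.isStarProjection a).isIdempotentElem.eq]
    push_cast
    rfl
  · intro b _ hb
    rw [smul_mul_smul_comm, P.orthogonal a b hb.symm, smul_zero]
  · simp

theorem commute_observable (j k : Fin m) : Commute (P.observable j) (P.observable k) := by
  rw [commute_iff_eq, observable_mul_observable, observable_mul_observable]
  simp only [mul_comm]

theorem isObservable_observable (k : Fin m) : IsObservable (P.observable k) where
  symm x y := by
    have h : IsSelfAdjoint (P.observable k) :=
      (isSelfAdjoint_sum _ fun a _ => (P.isStarProjection a).isSelfAdjoint).sub
        (isSelfAdjoint_sum _ fun a _ => (P.isStarProjection a).isSelfAdjoint)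
    exact h.isSymmetric x y
  mul_self := by
    rw [observable_mul_observable, ← P.sum_eq_one]
    simp

end ProjMeasurement

section Test

variable {HA : Type u} {HB : Type v}
  [NormedAddCommGroup HA] [InnerProductSpace ℂ HA] [CompleteSpace HA]
  [NormedAddCommGroup HB] [InnerProductSpace ℂ HB] [CompleteSpace HB] {m : ℕ}
  {A : Question m → ProjMeasurement (Answer m) HA}
  {B : Question m → ProjMeasurement (Answer m) HB}

theorem obs_castAdd (S : Fin (m + m) → Setting) (k : Fin m) :
    obs A B S (Fin.castAdd m k) = onAlice ((A fun i => S (Fin.castAdd m i)).observable k) := by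
  rw [obs, Fin.addCases_left]

theorem obs_natAdd (S : Fin (m + m) → Setting) (k : Fin m) :
    obs A B S (Fin.natAdd m k) = onBob ((B fun i => S (Fin.natAdd m i)).observable k) := by
  rw [obs, Fin.addCases_right]

theorem commute_obs_castAdd_natAdd (S S' : Fin (m + m) → Setting) (j k : Fin m) :
    Commute (obs A B S (Fin.castAdd m j)) (obs A B S' (Fin.natAdd m k)) := by
  rw [obs_castAdd, obs_natAdd]
  exact commute_onAlice_onBob _ _

/-- The observables of both players for one string of questions commute. -/
theorem observableFamily_obs (S : Fin (m + m) → Setting) : ObservableFamily (obs A B S) where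
  observable k := by
    refine Fin.addCases (fun k => ?_) (fun k => ?_) k
    · rw [obs_castAdd]
      exact isObservable_onAlice (ProjMeasurement.isObservable_observable _ _)
    · rw [obs_natAdd]
      exact isObservable_onBob (ProjMeasurement.isObservable_observable _ _)
  commute j k := by
    refine Fin.addCases (fun j => ?_) (fun j => ?_) j <;>
      refine Fin.addCases (fun k => ?_) (fun k => ?_) k
    · rw [obs_castAdd, obs_castAdd]
      exact commute_onAlice_onAlice (ProjMeasurement.commute_observable _ _ _)
    · exact commute_obs_castAdd_natAdd S S j k
    · exact (commute_obs_castAdd_natAdd S S k j).symm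
    · rw [obs_natAdd, obs_natAdd]
      exact commute_onBob_onBob (ProjMeasurement.commute_observable _ _ _)

variable {ψ : HilbertTensor HA HB} {ε : ℝ}

/-- Alice's answer to `X` or `Z` and Bob's answer to the complementary question almost agree,
whatever the other questions are. -/
theorem norm_obs_sub_obs_le (hψ : ‖ψ‖ = 1)
    (correlation : ∀ q r : Question m, (∀ j, q j = Setting.X ∨ q j = Setting.Z) →
      (∀ j, r j = Setting.X ∨ r j = Setting.Z) → ∀ k : Fin m, (q k).Complementary (r k) →
        expectation ψ (obs A B (Fin.append q r) (Fin.castAdd m k) *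
          obs A B (Fin.append q r) (Fin.natAdd m k)) ≥ 1 - ε)
    {S S' : Fin (m + m) → Setting} (hS : ∀ j, S j = Setting.X ∨ S j = Setting.Z)
    (hS' : ∀ j, S' j = Setting.X ∨ S' j = Setting.Z) {k : Fin m}
    (hk : (S (Fin.castAdd m k)).Complementary (S' (Fin.natAdd m k))) :
    ‖obs A B S (Fin.castAdd m k) ψ - obs A B S' (Fin.natAdd m k) ψ‖ ≤ √(2 * ε) := by
  refine norm_sub_le_of_correlation hψ ((observableFamily_obs S).observable _)
    ((observableFamily_obs S').observable _) ?_
  have h := correlation (fun i => S (Fin.castAdd m i)) (fun i => S' (Fin.natAdd m i))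
    (fun j => hS _) (fun j => hS' _) k hk
  rw [obs_castAdd, obs_natAdd] at h ⊢
  simpa only [Fin.append_left, Fin.append_right] using h

/-- The questions `Z…ZXZ…Z` with `X` in sub-test `k`, to both players. -/
def mixedQuestion (k : Fin m) : Fin (m + m) → Setting :=
  Fin.append (Function.update (fun _ => Setting.Z) k Setting.X)
    (Function.update (fun _ => Setting.Z) k Setting.X)

theorem mixedQuestion_eq_X_or_eq_Z (k : Fin m) (j : Fin (m + m)) :
    mixedQuestion k j = Setting.X ∨ mixedQuestion k j = Setting.Z := by
  refine Fin.addCases (fun j => ?_) (fun j => ?_) j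
  · rw [mixedQuestion, Fin.append_left, Function.update_apply]
    split_ifs <;> simp
  · rw [mixedQuestion, Fin.append_right, Function.update_apply]
    split_ifs <;> simp

theorem mixedQuestion_castAdd_self (k : Fin m) :
    mixedQuestion k (Fin.castAdd m k) = Setting.X := by
  rw [mixedQuestion, Fin.append_left, Function.update_self]

theorem mixedQuestion_natAdd_self (k : Fin m) :
    mixedQuestion k (Fin.natAdd m k) = Setting.X := by
  rw [mixedQuestion, Fin.append_right, Function.update_self]

theorem mixedQuestion_castAdd_of_ne {j k : Fin m} (h : j ≠ k) :
    mixedQuestion k (Fin.castAdd m j) = Setting.Z := by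
  rw [mixedQuestion, Fin.append_left, Function.update_of_ne h]

theorem mixedQuestion_natAdd_of_ne {j k : Fin m} (h : j ≠ k) :
    mixedQuestion k (Fin.natAdd m j) = Setting.Z := by
  rw [mixedQuestion, Fin.append_right, Function.update_of_ne h]

theorem norm_anticommutator_opX_opZ_le (hψ : ‖ψ‖ = 1) {i j : Fin (m + m)}
    (hij : ∀ S S', Commute (obs A B S i) (obs A B S' j))
    (h : expectation ψ (chshOp A B i j) ≥ 2 * √2 - ε) :
    ‖opX A B i (opZ A B i ψ) + opZ A B i (opX A B i ψ)‖ ≤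
      2 * (2 : ℝ) ^ (1 / 4 : ℝ) * √(2 * ε) :=
  norm_anticommutator_le hψ ((observableFamily_obs _).observable _)
    ((observableFamily_obs _).observable _) ((observableFamily_obs _).observable _)
    ((observableFamily_obs _).observable _) (hij _ _) (hij _ _) (hij _ _) (hij _ _) h

/-- Bob's observables for the mixed questions shadow those of Alice. -/
theorem shadowed_alice (hψ : ‖ψ‖ = 1)
    (chsh_AB : ∀ k : Fin m,
      expectation ψ (chshOp A B (Fin.castAdd m k) (Fin.natAdd m k)) ≥ 2 * √2 - ε)
    (correlation : ∀ q r : Question m, (∀ j, q j = Setting.X ∨ q j = Setting.Z) →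
      (∀ j, r j = Setting.X ∨ r j = Setting.Z) → ∀ k : Fin m, (q k).Complementary (r k) →
        expectation ψ (obs A B (Fin.append q r) (Fin.castAdd m k) *
          obs A B (Fin.append q r) (Fin.natAdd m k)) ≥ 1 - ε) :
    Shadowed (fun k => opX A B (Fin.castAdd m k)) (fun k => opZ A B (Fin.castAdd m k))
      (fun k j => obs A B (mixedQuestion k) (Fin.natAdd m j)) ψ √(2 * ε)
      (2 * (2 : ℝ) ^ (1 / 4 : ℝ) * √(2 * ε)) where
  family_X := (observableFamily_obs _).comp _
  family_Z := (observableFamily_obs _).comp _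
  family_R _ := (observableFamily_obs _).comp _
  commute_X _ _ _ := commute_obs_castAdd_natAdd _ _ _ _
  commute_Z _ _ _ := commute_obs_castAdd_natAdd _ _ _ _
  approx_X k _ hjk := norm_obs_sub_obs_le hψ correlation (fun _ => Or.inl rfl)
    (mixedQuestion_eq_X_or_eq_Z k) (Or.inl ⟨rfl, mixedQuestion_natAdd_of_ne hjk⟩)
  approx_Z k := norm_obs_sub_obs_le hψ correlation (fun _ => Or.inr rfl)
    (mixedQuestion_eq_X_or_eq_Z k) (Or.inr ⟨rfl, mixedQuestion_natAdd_self k⟩)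
  anticommute k := norm_anticommutator_opX_opZ_le hψ
    (fun S S' => commute_obs_castAdd_natAdd S S' k k) (chsh_AB k)

/-- Alice's observables for the mixed questions shadow those of Bob. -/
theorem shadowed_bob (hψ : ‖ψ‖ = 1)
    (chsh_BA : ∀ k : Fin m,
      expectation ψ (chshOp A B (Fin.natAdd m k) (Fin.castAdd m k)) ≥ 2 * √2 - ε)
    (correlation : ∀ q r : Question m, (∀ j, q j = Setting.X ∨ q j = Setting.Z) →
      (∀ j, r j = Setting.X ∨ r j = Setting.Z) → ∀ k : Fin m, (q k).Complementary (r k) →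
        expectation ψ (obs A B (Fin.append q r) (Fin.castAdd m k) *
          obs A B (Fin.append q r) (Fin.natAdd m k)) ≥ 1 - ε) :
    Shadowed (fun k => opX A B (Fin.natAdd m k)) (fun k => opZ A B (Fin.natAdd m k))
      (fun k j => obs A B (mixedQuestion k) (Fin.castAdd m j)) ψ √(2 * ε)
      (2 * (2 : ℝ) ^ (1 / 4 : ℝ) * √(2 * ε)) where
  family_X := (observableFamily_obs _).comp _
  family_Z := (observableFamily_obs _).comp _
  family_R _ := (observableFamily_obs _).comp _
  commute_X _ _ _ := (commute_obs_castAdd_natAdd _ _ _ _).symm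
  commute_Z _ _ _ := (commute_obs_castAdd_natAdd _ _ _ _).symm
  approx_X k _ hjk := by
    rw [norm_sub_rev]
    exact norm_obs_sub_obs_le hψ correlation (mixedQuestion_eq_X_or_eq_Z k) (fun _ => Or.inl rfl)
      (Or.inr ⟨mixedQuestion_castAdd_of_ne hjk, rfl⟩)
  approx_Z k := by
    rw [norm_sub_rev]
    exact norm_obs_sub_obs_le hψ correlation (mixedQuestion_eq_X_or_eq_Z k) (fun _ => Or.inr rfl)
      (Or.inl ⟨mixedQuestion_castAdd_self k, rfl⟩)
  anticommute k := norm_anticommutator_opX_opZ_le hψ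
    (fun S S' => (commute_obs_castAdd_natAdd S' S k k).symm) (chsh_BA k)

/-- Passing the test with error `ε` implies the approximate Pauli relations. -/
theorem approxPauli_of_test (hψ : ‖ψ‖ = 1)
    (chsh_AB : ∀ k : Fin m,
      expectation ψ (chshOp A B (Fin.castAdd m k) (Fin.natAdd m k)) ≥ 2 * √2 - ε)
    (chsh_BA : ∀ k : Fin m,
      expectation ψ (chshOp A B (Fin.natAdd m k) (Fin.castAdd m k)) ≥ 2 * √2 - ε)
    (correlation : ∀ q r : Question m, (∀ j, q j = Setting.X ∨ q j = Setting.Z) →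
      (∀ j, r j = Setting.X ∨ r j = Setting.Z) → ∀ k : Fin m, (q k).Complementary (r k) →
        expectation ψ (obs A B (Fin.append q r) (Fin.castAdd m k) *
          obs A B (Fin.append q r) (Fin.natAdd m k)) ≥ 1 - ε) :
    ApproxPauli (opX A B) (opZ A B) ψ
      ((3 * m - 2) * √(2 * ε) + 2 * (2 : ℝ) ^ (1 / 4 : ℝ) * √(2 * ε)) √(2 * ε) where
  family_X := observableFamily_obs fun _ => Setting.X
  family_Z := observableFamily_obs fun _ => Setting.Z
  commute_XZ _ _ := commute_obs_castAdd_natAdd _ _ _ _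
  commute_ZX _ _ := commute_obs_castAdd_natAdd _ _ _ _
  left := (shadowed_alice hψ chsh_AB correlation).norm_bitPow_Z_bitPow_X_sub_le
    (Real.sqrt_nonneg _) (by positivity)
  right := (shadowed_bob hψ chsh_BA correlation).norm_bitPow_Z_bitPow_X_sub_le
    (Real.sqrt_nonneg _) (by positivity)
  swap_left _ := norm_obs_sub_obs_le hψ correlation (fun _ => Or.inl rfl) (fun _ => Or.inr rfl)
    (Or.inl ⟨rfl, rfl⟩)
  swap_right _ := by
    rw [norm_sub_rev]
    exact norm_obs_sub_obs_le hψ correlation (fun _ => Or.inr rfl) (fun _ => Or.inl rfl)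
      (Or.inr ⟨rfl, rfl⟩)

end Test

end ParallelSelfTest

theorem mainTheorem4 {HA : Type u} {HB : Type v}
    [NormedAddCommGroup HA] [InnerProductSpace ℂ HA] [CompleteSpace HA]
    [NormedAddCommGroup HB] [InnerProductSpace ℂ HB] [CompleteSpace HB]
    (m : ℕ)
    (A : ParallelSelfTest.Question m →
      ParallelSelfTest.ProjMeasurement (ParallelSelfTest.Answer m) HA)
    (B : ParallelSelfTest.Question m →
      ParallelSelfTest.ProjMeasurement (ParallelSelfTest.Answer m) HB)
    (ψ' : ParallelSelfTest.HilbertTensor HA HB) (hψ' : ‖ψ'‖ = 1) (ε : ℝ)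
    (chsh_AB : ∀ k : Fin m,
      ParallelSelfTest.expectation ψ'
        (ParallelSelfTest.chshOp A B (Fin.castAdd m k) (Fin.natAdd m k)) ≥ 2 * √2 - ε)
    (chsh_BA : ∀ k : Fin m,
      ParallelSelfTest.expectation ψ'
        (ParallelSelfTest.chshOp A B (Fin.natAdd m k) (Fin.castAdd m k)) ≥ 2 * √2 - ε)
    (correlation : ∀ q r : ParallelSelfTest.Question m,
      (∀ j, q j = ParallelSelfTest.Setting.X ∨ q j = ParallelSelfTest.Setting.Z) →
      (∀ j, r j = ParallelSelfTest.Setting.X ∨ r j = ParallelSelfTest.Setting.Z) →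
      ∀ k : Fin m, (q k).Complementary (r k) →
        ParallelSelfTest.expectation ψ'
          (ParallelSelfTest.obs A B (Fin.append q r) (Fin.castAdd m k) *
            ParallelSelfTest.obs A B (Fin.append q r) (Fin.natAdd m k)) ≥ 1 - ε) :
    ∃ (J : Type (max u v)) (_ : NormedAddCommGroup J) (_ : InnerProductSpace ℂ J)
      (_ : CompleteSpace J) (junk : J)
      (Φ : ParallelSelfTest.HilbertTensor HA HB →ₗᵢ[ℂ] J ⊗[ℂ] ParallelSelfTest.Qubits (m + m)),
      ‖junk‖ = 1 ∧
      ∀ p q : ParallelSelfTest.BitString (m + m),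
        ‖Φ ((ParallelSelfTest.bitPow (ParallelSelfTest.opX A B) q *
              ParallelSelfTest.bitPow (ParallelSelfTest.opZ A B) p) ψ') -
            junk ⊗ₜ[ℂ] ((ParallelSelfTest.bitPow ParallelSelfTest.pauliX q *
              ParallelSelfTest.bitPow ParallelSelfTest.pauliZ p)
                (ParallelSelfTest.idealState m))‖ ≤
          ParallelSelfTest.errorBound (m + m) (hammingNorm p) ε := by
  have h := ParallelSelfTest.approxPauli_of_test hψ' chsh_AB chsh_BA correlation
  have hη : 0 ≤ √(2 * ε) := Real.sqrt_nonneg _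
  have hβ := ParallelSelfTest.one_le_two_rpow_quarter
  have hm : (0 : ℝ) ≤ m := Nat.cast_nonneg m
  have hg : 0 ≤ (3 * m - 2) * √(2 * ε) + 2 * (2 : ℝ) ^ (1 / 4 : ℝ) * √(2 * ε) := by
    rw [← add_mul]
    exact mul_nonneg (by linarith) hη
  obtain ⟨junk, hjunk, hbound⟩ := h.exists_junk_norm_extraction_sub_le hψ' hg hη
  refine ⟨ParallelSelfTest.HilbertTensor HA HB, inferInstance, inferInstance, inferInstance, junk,
    ParallelSelfTest.extraction h.family_X h.family_Z, hjunk, fun p q => ?_⟩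
  refine ParallelSelfTest.le_errorBound (ParallelSelfTest.hammingNorm_le p) (norm_nonneg _) ?_ ?_
  · refine (norm_sub_le _ _).trans ?_
    rw [LinearIsometry.norm_map, mul_apply_eq_comp, h.family_X.norm_bitPow_apply,
      h.family_Z.norm_bitPow_apply, hψ', TensorProduct.norm_tmul, hjunk,
      ParallelSelfTest.norm_pauli_idealState]
    norm_num
  · refine (hbound p q).trans (le_of_eq ?_)
    push_cast
    ring
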